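/- Let $d\ge 3$, let $\mathbb S^{d-1}\subset\mathbb R^d$ be the Euclidean unit sphere with its Borel $\sigma$-algebra and surface measure $\sigma_{d-1}$, and let $\omega_{k}=\sigma_{k}(\mathbb S^{k})$. For $x\in\mathbb S^{d-1}$ let $\mathbb S_x^{d-2}=\{v\in\mathbb S^{d-1}:\langle v,x\rangle=0\}$ with its surface measure $\mu_x$ (of total mass $\omega_{d-2}$), and for $v\in\mathbb S_x^{d-2}$ let $\gamma_{(x,v)}(\theta)=\cos(\theta)x+\sin(\theta)v$. Let $p:\mathbb S^{d-1}\to(0,\infty)$ be lower semi-continuous, and suppose that for some Borel set $C\subseteq\mathbb S^{d-1}$ with $\sigma_{d-1}(C)>0$ $$0<\inf_{x\in C}p(x)\qquad\text{and}\qquad \sup_{x\in\mathbb S^{d-1}}p(x)<\infty .$$ Let $\pi(\mathrm dx)=\frac1Z\,p(x)\,\sigma_{d-1}(\mathrm dx)$ with $Z=\int_{\mathbb S^{d-1}} p\,\mathrm d\sigma_{d-1}$. For $x\in\mathbb S^{d-1}$, $v\in\mathbb S_x^{d-2}$ and $t\in(0,p(x))$, let $Q_{x,v,t}$ be the distribution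 on $[0,2\pi)$ of the output, taken modulo $2\pi$, of the following shrinkage procedure: draw $\theta\sim\mathcal U(0,2\pi)$ and set $\theta_{\min}=\theta-2\pi$, $\theta_{\max}=\theta$; while $p(\gamma_{(x,v)}(\theta))\le t$, set $\theta_{\min}=\theta$ if $\theta<0$ and $\theta_{\max}=\theta$ otherwise, and draw a new $\theta\sim\mathcal U(\theta_{\min},\theta_{\max})$; output $\theta$. The geodesic shrinkage slice sampler has the transition probabilities $$\widetilde H(x,A)=\frac1{p(x)}\int_0^{p(x)}\frac1{\omega_{d-2}}\int_{\mathbb S_x^{d-2}}\int_{[0,2\pi)}\mathbf 1_A\big(\gamma_{(x,v)}(\theta)\big)\,Q_{x,v,t}(\mathrm d\theta)\,\mu_x(\mathrm dv)\,\mathrm dt .$$ Set $$\beta=\frac{\inf_{y\in C}p(y)}{\sup_{y\in\mathbb S^{d-1}}p(y)},\qquad \rho=1-\frac{\beta}{2\pi}\,\frac{\sigma_{d-1}(C)}{\omega_{d-2}} .$$ Then $\beta\in(0,1]$, $\rho\in(0,1)$, $\widetilde H$ is a Markov kernel on $\mathbb S^{d-1}$, and for all $n\in\mathbb N$ $$\sup_{x\in\mathbb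 S^{d-1}} d_{\mathrm{TV}}\big(\widetilde H^n(x,\cdot),\pi\big)\le\rho^n ,$$ where $d_{\mathrm{TV}}(\mu,\nu)=\sup_A|\mu(A)-\nu(A)|$, the supremum being over Borel sets $A$. -/

import Mathlib

open MeasureTheory ProbabilityTheory Set

open scoped ENNReal RealInnerProductSpace

noncomputable section

namespace GeodesicSlice

/-- The Euclidean unit sphere `S^{d-1}` of `ℝ^d`, with its Borel sigma-algebra. -/
abbrev Sph (d : ℕ) : Type :=
  ↥(Metric.sphere (0 : EuclideanSpace ℝ (Fin d)) 1)

/-- The canonical surface measure on the unit sphere of a finite-dimensional Euclidean space,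
obtained from the Lebesgue measure of that space by polar coordinates. -/
def surface (F : Type*) [NormedAddCommGroup F] [InnerProductSpace ℝ F] [FiniteDimensional ℝ F]
    [MeasurableSpace F] [BorelSpace F] : Measure ↥(Metric.sphere (0 : F) 1) :=
  (volume : Measure F).toSphere

/-- The volume measure `σ_{d-1}` on `S^{d-1}`. -/
def sigma (d : ℕ) : Measure (Sph d) := surface (EuclideanSpace ℝ (Fin d))

/-- The total surface area of the unit sphere `S^{k-1}` of `ℝ^k`. -/
def area (k : ℕ) : ℝ := (sigma k).real univ

/-- The tangent space `E_x = {y | ⟪y, x⟫ = 0}` of the sphere at `x`. -/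
abbrev Tangent {d : ℕ} (x : Sph d) : Submodule ℝ (EuclideanSpace ℝ (Fin d)) :=
  (Submodule.span ℝ {(x : EuclideanSpace ℝ (Fin d))})ᗮ

/-- The great subsphere `S_x^{d-2}` with pole `x`: the unit sphere of the tangent space at `x`. -/
abbrev UnitTangent {d : ℕ} (x : Sph d) : Type :=
  ↥(Metric.sphere (0 : Tangent x) 1)

/-- The volume measure `μ_x` on the great subsphere with pole `x`. -/
def tangentSigma {d : ℕ} (x : Sph d) : Measure (UnitTangent x) := surface (Tangent x)

/-- The great circle `γ_{(x,v)}(θ) = cos θ • x + sin θ • v`. -/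
def geodesic {d : ℕ} (x : Sph d) (v : UnitTangent x) (θ : ℝ) : Sph d :=
  ⟨Real.cos θ • (x : EuclideanSpace ℝ (Fin d)) +
      Real.sin θ • ((v : Tangent x) : EuclideanSpace ℝ (Fin d)), by
    have hx : ‖(x : EuclideanSpace ℝ (Fin d))‖ = 1 := by simp
    have hv : ‖((v : Tangent x) : EuclideanSpace ℝ (Fin d))‖ = 1 := by
      have h := mem_sphere_zero_iff_norm.1 v.2
      rwa [Submodule.coe_norm] at h
    have hxv : ⟪(x : EuclideanSpace ℝ (Fin d)),
        ((v : Tangent x) : EuclideanSpace ℝ (Fin d))⟫ = 0 :=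
      Submodule.mem_orthogonal_singleton_iff_inner_right.1 (v : Tangent x).2
    have hsq : ‖Real.cos θ • (x : EuclideanSpace ℝ (Fin d)) +
        Real.sin θ • ((v : Tangent x) : EuclideanSpace ℝ (Fin d))‖ ^ 2 = 1 := by
      rw [norm_add_sq_real, norm_smul, norm_smul, hx, hv, inner_smul_left, inner_smul_right, hxv]
      simp
    rw [mem_sphere_zero_iff_norm]
    exact (sq_eq_sq₀ (norm_nonneg _) zero_le_one).1 (by rw [hsq, one_pow])⟩

/-- The unnormalised mass `Z = ∫ p dσ` of a positive function `p`. -/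
def mass {d : ℕ} (p : Sph d → ℝ) : ℝ≥0∞ := ∫⁻ x, ENNReal.ofReal (p x) ∂(sigma d)

/-- The target distribution `π(dx) = Z⁻¹ p(x) σ(dx)`. -/
def target {d : ℕ} (p : Sph d → ℝ) : Measure (Sph d) :=
  (mass p)⁻¹ • (sigma d).withDensity (fun x => ENNReal.ofReal (p x))

/-- The total variation distance `sup_A |μ(A) - ν(A)|` of two probability measures, as an extended
nonnegative number. -/
def dTV {α : Type*} [MeasurableSpace α] (μ ν : Measure α) : ℝ≥0∞ :=
  ⨆ (A : Set α) (_ : MeasurableSet A), ENNReal.ofReal |μ.real A - ν.real A|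

/-! The shrinkage procedure for a set `S` of accepted angles. A state `(a, b, θ)` consists of the
current bracket `(a, b) = (θ_min, θ_max)` and the current candidate `θ`. -/

/-- The uniform distribution on the interval `(a, b)`. -/
def unif (a b : ℝ) : Measure ℝ := (volume (Ioo a b))⁻¹ • volume.restrict (Ioo a b)

/-- Law of the initial state: `θ` is uniform on `(0, 2π)` and the bracket is `(θ - 2π, θ)`. -/
def shrinkInit : Measure (ℝ × ℝ × ℝ) :=
  (unif 0 (2 * Real.pi)).map (fun θ => (θ - 2 * Real.pi, θ, θ))

/-- The bracket after the candidate `θ` of the state `(a, b, θ)` was rejected. -/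
def shrunkBracket (s : ℝ × ℝ × ℝ) : ℝ × ℝ :=
  if s.2.2 < 0 then (s.2.2, s.2.1) else (s.1, s.2.2)

/-- Law of the state after one pass through the body of the loop: the bracket is shrunk and a new
candidate is drawn uniformly from the new bracket. -/
def shrinkBody (s : ℝ × ℝ × ℝ) : Measure (ℝ × ℝ × ℝ) :=
  (unif (shrunkBracket s).1 (shrunkBracket s).2).map
    (fun θ => ((shrunkBracket s).1, (shrunkBracket s).2, θ))

lemma measurable_shrunkBracket : Measurable shrunkBracket := by
  unfold shrunkBracket
  refine Measurable.ite (measurableSet_lt (by fun_prop) (by fun_prop)) ?_ ?_ <;> fun_prop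

/-- `shrinkBody` is measurable, so that integrating it against a law of states is meaningful. -/
lemma measurable_shrinkBody : Measurable shrinkBody := by
  have key : Measurable (fun q : ℝ × ℝ => (unif q.1 q.2).map (fun θ : ℝ => (q.1, q.2, θ))) := by
    refine Measure.measurable_of_measurable_coe _ fun A hA => ?_
    have hm : ∀ q : ℝ × ℝ, Measurable (fun θ : ℝ => (q.1, q.2, θ)) := fun q => by fun_prop
    have hB : MeasurableSet {z : (ℝ × ℝ) × ℝ |
        (z.1.1, z.1.2, z.2) ∈ A ∧ z.1.1 < z.2 ∧ z.2 < z.1.2} := by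
      refine MeasurableSet.inter ?_ (MeasurableSet.inter ?_ ?_)
      · exact (show Measurable (fun z : (ℝ × ℝ) × ℝ => (z.1.1, z.1.2, z.2)) by fun_prop) hA
      · exact measurableSet_lt (f := fun z : (ℝ × ℝ) × ℝ => z.1.1) (g := fun z => z.2)
          (by fun_prop) (by fun_prop)
      · exact measurableSet_lt (f := fun z : (ℝ × ℝ) × ℝ => z.2) (g := fun z => z.1.2)
          (by fun_prop) (by fun_prop)
    have heq : (fun q : ℝ × ℝ => (unif q.1 q.2).map (fun θ : ℝ => (q.1, q.2, θ)) A) =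
        fun q : ℝ × ℝ => (ENNReal.ofReal (q.2 - q.1))⁻¹ * volume (Prod.mk q ⁻¹'
          {z : (ℝ × ℝ) × ℝ | (z.1.1, z.1.2, z.2) ∈ A ∧ z.1.1 < z.2 ∧ z.2 < z.1.2}) := by
      funext q
      rw [Measure.map_apply (hm q) hA, unif, Measure.smul_apply, smul_eq_mul, Real.volume_Ioo,
        Measure.restrict_apply ((hm q) hA)]
      rfl
    rw [heq]
    refine Measurable.mul ?_ (measurable_measure_prodMk_left hB)
    fun_prop
  exact key.comp measurable_shrunkBracket

/-- Sub-probability law of the state at the `n`-th evaluation of the loop condition, on the event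
that the first `n` candidates were all rejected. -/
def shrinkRun (S : Set ℝ) : ℕ → Measure (ℝ × ℝ × ℝ)
  | 0 => shrinkInit
  | n + 1 => ((shrinkRun S n).restrict {s | s.2.2 ∉ S}).bind shrinkBody

/-- Law of the first accepted candidate modulo `2π`: the sum over `n` of its law on the event that
exactly `n` candidates were rejected before. -/
def shrinkLaw (S : Set ℝ) : Measure ℝ :=
  Measure.sum fun n => ((shrinkRun S n).restrict {s | s.2.2 ∈ S}).map
    (fun s => toIcoMod Real.two_pi_pos 0 s.2.2)

/-- The shrinkage distribution `Q_{x,v,t}` on `[0, 2π)`. -/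
def shrinkDist {d : ℕ} (p : Sph d → ℝ) (x : Sph d) (v : UnitTangent x) (t : ℝ) : Measure ℝ :=
  shrinkLaw {θ | t < p (geodesic x v θ)}

/-- The level set kernel `H̃_t(x, A)`. -/
def levelKernel {d : ℕ} (p : Sph d → ℝ) (t : ℝ) (x : Sph d) (A : Set (Sph d)) : ℝ≥0∞ :=
  (ENNReal.ofReal (area (d - 1)))⁻¹ *
    ∫⁻ v, ∫⁻ θ in Ico 0 (2 * Real.pi), A.indicator 1 (geodesic x v θ)
      ∂(shrinkDist p x v t) ∂(tangentSigma x)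

/-- The transition probabilities `H̃(x, A)` of the geodesic shrinkage slice sampler. -/
def sssTransition {d : ℕ} (p : Sph d → ℝ) (x : Sph d) (A : Set (Sph d)) : ℝ≥0∞ :=
  (ENNReal.ofReal (p x))⁻¹ * ∫⁻ t in Ioo 0 (p x), levelKernel p t x A

end GeodesicSlice

end

/-!
The theorem is Doeblin's: the kernel `H` dominates a fixed measure of mass `1 - ρ` from every
starting point, and `π` is invariant, so that every step shrinks the range of `x ↦ Hⁿ(x, A)` by the
factor `ρ` (`dTV_pow_le`).

*Minorization* (`le_sssKernel`). With only the first candidate of the shrinkage procedure and only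
the levels `t < β p(x)`, at which all of `C` is accepted, `H(x, A)` is at least
`β / (2π ω)` times `∫∫ 1_{A ∩ C}(γ_{(x,v)}(θ)) dθ μ_x(dv)`. Polar coordinates around `x` have the
density `sin ^ (d - 2) θ ≤ 1`, so this double integral is at least `σ(A ∩ C)`
(`lintegral_sigma_le`). The same estimate bounds `σ(S^{d-1})` by `π ω` and gives `ρ > 0`.

*Invariance* (`target_bind_sssKernel`). By integration over the levels it suffices that each level
set kernel leaves `σ` restricted to `{p > t}` invariant. Two facts are combined.

* Detailed balance of the shrinkage procedure. Two centres that no rejected candidate has separated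
  see the same brackets, and therefore the procedure with exactly `n` rejections is symmetric for
  Lebesgue measure on a fixed bracket (`lintegral_mul_retry_comm`, by induction on `n`). The first
  bracket is the circle cut at the first candidate. For any measure that is invariant under a circle
  flow one may move the origin to this cut, and symmetry on the fixed bracket `(-2π, 0)` becomes
  symmetry along the flow (`lintegral_mul_fullTurn_comm`).
* Liouville's theorem: the geodesic flow preserves `σ(dx) μ_x(dv)`
  (`measurePreserving_geodesicFlow`). The flow commutes with the orthogonal group, which acts
  transitively on orthonormal pairs, and an invariant finite measure on one orbit is determined by
  its mass (`measure_mul_eq_of_invariant`, applied with Haar measure).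

Symmetry gives invariance once the procedure is known to stop almost surely. The level set is open,
so the bracket always contains a fixed accepted interval around the centre and the number of
rejections has a geometric tail (`tsum_fullTurn`).

The measures `μ_x` live on different types. Their dependence on `x` is controlled by writing each of
them as an integral over the ambient space (`lintegral_tangentSigma`); joint measurability and
equivariance under isometries follow from this formula.
-/

noncomputable section

namespace GeodesicSlice

/-! ### The uniform distribution on an interval -/

instance (a b : ℝ) : SFinite (unif a b) := by unfold unif; infer_instance

lemma lintegral_unif (a b : ℝ) (f : ℝ → ℝ≥0∞) :
    ∫⁻ θ, f θ ∂unif a b = (ENNReal.ofReal (b - a))⁻¹ * ∫⁻ θ in Ioo a b, f θ := by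
  rw [unif, lintegral_smul_measure, Real.volume_Ioo, smul_eq_mul]

lemma unif_univ {a b : ℝ} (hab : a < b) : unif a b univ = 1 := by
  rw [unif, Measure.smul_apply, Measure.restrict_apply_univ, smul_eq_mul]
  apply ENNReal.inv_mul_cancel <;> simp [hab]

lemma ae_unif_mem_Ioo (a b : ℝ) : ∀ᵐ θ ∂unif a b, θ ∈ Ioo a b :=
  (Measure.smul_absolutelyContinuous).ae_le (ae_restrict_mem measurableSet_Ioo)

lemma measurable_lintegral_unif {Y : Type*} [MeasurableSpace Y] {F : Y × ℝ → ℝ≥0∞}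
    (hF : Measurable F) {a b : Y → ℝ} (ha : Measurable a) (hb : Measurable b) :
    Measurable fun y => ∫⁻ θ, F (y, θ) ∂unif (a y) (b y) := by
  simp_rw [lintegral_unif, ← lintegral_indicator measurableSet_Ioo]
  refine Measurable.mul (by fun_prop) ?_
  have hS : MeasurableSet {z : Y × ℝ | a z.1 < z.2 ∧ z.2 < b z.1} :=
    (measurableSet_lt (ha.comp measurable_fst) measurable_snd).inter
      (measurableSet_lt measurable_snd (hb.comp measurable_fst))
  exact (hF.indicator hS).lintegral_prod_right'

lemma lintegral_unif_comp_add (f : ℝ → ℝ≥0∞) (a b u : ℝ) :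
    ∫⁻ θ, f (θ + u) ∂unif a b = ∫⁻ θ, f θ ∂unif (a + u) (b + u) := by
  rw [lintegral_unif, lintegral_unif, show b + u - (a + u) = b - a by ring]
  congr 1
  rw [← lintegral_indicator measurableSet_Ioo, ← lintegral_indicator measurableSet_Ioo,
    ← lintegral_add_right_eq_self (μ := volume) ((Ioo (a + u) (b + u)).indicator f) u]
  refine lintegral_congr fun θ => ?_
  simp only [indicator, mem_Ioo, add_lt_add_iff_right]

lemma lintegral_unif_comp_neg (f : ℝ → ℝ≥0∞) (a b : ℝ) :
    ∫⁻ θ, f (-θ) ∂unif a b = ∫⁻ θ, f θ ∂unif (-b) (-a) := by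
  rw [lintegral_unif, lintegral_unif, show -a - -b = b - a by ring]
  congr 1
  rw [← lintegral_indicator measurableSet_Ioo, ← lintegral_indicator measurableSet_Ioo,
    ← lintegral_neg_eq_self (μ := volume) ((Ioo (-b) (-a)).indicator f)]
  refine lintegral_congr fun θ => ?_
  simp only [indicator, mem_Ioo, neg_lt_neg_iff, and_comm]

/-! ### The shrinkage procedure with a fixed centre -/

/-- Integral of `g` against the law of the candidate drawn after exactly `n` further rejections,
when the shrinkage procedure is continued from the bracket `(a, b)`. A candidate `θ` is rejected
with weight `r θ`, and the bracket then keeps only its part on the side of `θ` where the centre `c`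
lies. -/
def retry (r g : ℝ → ℝ≥0∞) (c : ℝ) : ℕ → ℝ → ℝ → ℝ≥0∞
  | 0, a, b => ∫⁻ θ, g θ ∂unif a b
  | n + 1, a, b =>
    ∫⁻ θ, r θ * (if θ < c then retry r g c n θ b else retry r g c n a θ) ∂unif a b

lemma measurable_retry {Y : Type*} [MeasurableSpace Y] {r g : Y → ℝ → ℝ≥0∞}
    (hr : Measurable (Function.uncurry r)) (hg : Measurable (Function.uncurry g)) (n : ℕ) :
    Measurable fun q : Y × ℝ × ℝ × ℝ => retry (r q.1) (g q.1) q.2.1 n q.2.2.1 q.2.2.2 := by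
  induction n with
  | zero =>
    simp only [retry]
    refine measurable_lintegral_unif (F := fun z : (Y × ℝ × ℝ × ℝ) × ℝ => g z.1.1 z.2)
      ?_ (by fun_prop) (by fun_prop)
    exact hg.comp (f := fun z : (Y × ℝ × ℝ × ℝ) × ℝ => (z.1.1, z.2)) (by fun_prop)
  | succ n ih =>
    simp only [retry]
    refine measurable_lintegral_unif (F := fun z : (Y × ℝ × ℝ × ℝ) × ℝ => r z.1.1 z.2 *
      (if z.2 < z.1.2.1 then retry (r z.1.1) (g z.1.1) z.1.2.1 n z.2 z.1.2.2.2
        else retry (r z.1.1) (g z.1.1) z.1.2.1 n z.1.2.2.1 z.2))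
      ?_ (by fun_prop) (by fun_prop)
    refine Measurable.mul ?_ (Measurable.ite (measurableSet_lt (by fun_prop) (by fun_prop)) ?_ ?_)
    · exact hr.comp (f := fun z : (Y × ℝ × ℝ × ℝ) × ℝ => (z.1.1, z.2)) (by fun_prop)
    · exact ih.comp (f := fun z : (Y × ℝ × ℝ × ℝ) × ℝ => (z.1.1, z.1.2.1, z.2, z.1.2.2.2))
        (by fun_prop)
    · exact ih.comp (f := fun z : (Y × ℝ × ℝ × ℝ) × ℝ => (z.1.1, z.1.2.1, z.1.2.2.1, z.2))
        (by fun_prop)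

lemma retry_comp_add (r g : ℝ → ℝ≥0∞) (c u : ℝ) (n : ℕ) (a b : ℝ) :
    retry (fun θ => r (θ + u)) (fun θ => g (θ + u)) c n a b =
      retry r g (c + u) n (a + u) (b + u) := by
  induction n generalizing a b with
  | zero => exact lintegral_unif_comp_add g a b u
  | succ n ih =>
    simp only [retry, ih]
    rw [← lintegral_unif_comp_add _ a b u]
    simp only [add_lt_add_iff_right]

/-- Detailed balance of the shrinkage procedure inside a fixed bracket: two points that are never
separated by the rejected candidates see the same sequence of brackets. -/
lemma lintegral_mul_retry_comm {r f g : ℝ → ℝ≥0∞} (hr : Measurable r) (hf : Measurable f)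
    (hg : Measurable g) (n : ℕ) (a b : ℝ) :
    ∫⁻ c in Ioo a b, f c * retry r g c n a b = ∫⁻ c in Ioo a b, g c * retry r f c n a b := by
  induction n generalizing a b with
  | zero =>
    simp only [retry]
    rw [lintegral_mul_const _ hf, lintegral_mul_const _ hg, lintegral_unif, lintegral_unif]
    ring
  | succ n ih =>
    -- exchanging the integrals, the centre ranges over the part of the bracket that survives
    have key : ∀ {f g : ℝ → ℝ≥0∞}, Measurable f → Measurable g →
        ∫⁻ c in Ioo a b, f c * retry r g c (n + 1) a b =
          (ENNReal.ofReal (b - a))⁻¹ * ∫⁻ θ in Ioo a b, r θ *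
            ((∫⁻ c in Ioo θ b, f c * retry r g c n θ b) +
              ∫⁻ c in Ioo a θ, f c * retry r g c n a θ) := by
      intro f g hf hg
      have hmeas : Measurable fun q : ℝ × ℝ × ℝ × ℝ => retry r g q.2.1 n q.2.2.1 q.2.2.2 :=
        measurable_retry (Y := ℝ) (r := fun _ => r) (g := fun _ => g)
          (hr.comp measurable_snd) (hg.comp measurable_snd) n
      have hm1 : Measurable fun q : ℝ × ℝ => retry r g q.1 n q.2 b :=
        hmeas.comp (f := fun q : ℝ × ℝ => (0, q.1, q.2, b)) (by fun_prop)
      have hm2 : Measurable fun q : ℝ × ℝ => retry r g q.1 n a q.2 :=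
        hmeas.comp (f := fun q : ℝ × ℝ => (0, q.1, a, q.2)) (by fun_prop)
      have hm3 : Measurable fun q : ℝ × ℝ =>
          if q.2 < q.1 then retry r g q.1 n q.2 b else retry r g q.1 n a q.2 :=
        Measurable.ite (measurableSet_lt measurable_snd measurable_fst) hm1 hm2
      have hm4 : Measurable fun q : ℝ × ℝ => f q.1 * (r q.2 *
          if q.2 < q.1 then retry r g q.1 n q.2 b else retry r g q.1 n a q.2) :=
        (hf.comp measurable_fst).mul ((hr.comp measurable_snd).mul hm3)
      calc ∫⁻ c in Ioo a b, f c * retry r g c (n + 1) a b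
          = ∫⁻ c in Ioo a b, (ENNReal.ofReal (b - a))⁻¹ * ∫⁻ θ in Ioo a b, f c * (r θ *
              if θ < c then retry r g c n θ b else retry r g c n a θ) := by
            refine lintegral_congr fun c => ?_
            rw [retry, lintegral_unif, lintegral_const_mul]
            · ring
            · exact (hr.mul (hm3.comp (f := fun θ : ℝ => (c, θ)) (by fun_prop)))
        _ = (ENNReal.ofReal (b - a))⁻¹ * ∫⁻ θ in Ioo a b, ∫⁻ c in Ioo a b, f c * (r θ *
              if θ < c then retry r g c n θ b else retry r g c n a θ) := by
            rw [lintegral_const_mul, lintegral_lintegral_swap]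
            · exact hm4.aemeasurable
            · exact hm4.lintegral_prod_right'
        _ = _ := by
            congr 1
            refine setLIntegral_congr_fun measurableSet_Ioo fun θ hθ => ?_
            have hsplit : Ioo a b = Ioc a θ ∪ Ioo θ b := (Ioc_union_Ioo_eq_Ioo hθ.1.le hθ.2).symm
            have hm5 : Measurable fun c => f c * retry r g c n θ b :=
              hf.mul (hm1.comp (f := fun c : ℝ => (c, θ)) (by fun_prop))
            have hm6 : Measurable fun c => f c * retry r g c n a θ :=
              hf.mul (hm2.comp (f := fun c : ℝ => (c, θ)) (by fun_prop))
            rw [hsplit, lintegral_union measurableSet_Ioo, add_comm, mul_add,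
              ← lintegral_const_mul _ hm5, ← lintegral_const_mul _ hm6]
            · congr 1
              · refine setLIntegral_congr_fun measurableSet_Ioo fun c hc => ?_
                simp only [if_pos hc.1]; ring
              · rw [← setLIntegral_congr (Ioo_ae_eq_Ioc (a := a) (b := θ))]
                refine setLIntegral_congr_fun measurableSet_Ioo fun c hc => ?_
                simp only [if_neg hc.2.not_gt]; ring
            · exact Set.disjoint_left.2 fun c h1 h2 => h1.2.not_gt h2.1
    rw [key hf hg, key hg hf]
    simp_rw [ih]

/-! ### The shrinkage procedure on the full circle -/

/-- Integral of `g` against the law of the candidate drawn after exactly `n` rejections in the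
shrinkage procedure on the whole circle, with centre `0` and rejection weight `r`. -/
def fullTurn (r g : ℝ → ℝ≥0∞) : ℕ → ℝ≥0∞
  | 0 => ∫⁻ θ, g θ ∂unif 0 (2 * Real.pi)
  | n + 1 => ∫⁻ θ, r θ * retry r g 0 n (θ - 2 * Real.pi) θ ∂unif 0 (2 * Real.pi)

lemma measurable_fullTurn {Y : Type*} [MeasurableSpace Y] {r g : Y → ℝ → ℝ≥0∞}
    (hr : Measurable (Function.uncurry r)) (hg : Measurable (Function.uncurry g)) (n : ℕ) :
    Measurable fun y => fullTurn (r y) (g y) n := by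
  cases n with
  | zero =>
    exact measurable_lintegral_unif hg measurable_const measurable_const
  | succ n =>
    refine measurable_lintegral_unif (F := fun q : Y × ℝ => r q.1 q.2 *
      retry (r q.1) (g q.1) 0 n (q.2 - 2 * Real.pi) q.2) (hr.mul ?_)
      measurable_const measurable_const
    exact (measurable_retry hr hg n).comp
      (f := fun q : Y × ℝ => (q.1, 0, q.2 - 2 * Real.pi, q.2)) (by fun_prop)

/-- Detailed balance of the shrinkage procedure along a measure-preserving circle flow. Moving the
origin to the first rejected candidate turns the initial bracket into the fixed bracket
`(-2π, 0)`. -/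
lemma lintegral_mul_fullTurn_comm {Z : Type*} [MeasurableSpace Z] {m : Measure Z} [SFinite m]
    {T : ℝ → Z → Z} (hT : Measurable (Function.uncurry T))
    (hadd : ∀ s u z, T (s + u) z = T s (T u z)) (hper : ∀ z, T (2 * Real.pi) z = z)
    (hm : ∀ u, MeasurePreserving (T u) m m) {r f g : Z → ℝ≥0∞}
    (hr : Measurable r) (hf : Measurable f) (hg : Measurable g) (n : ℕ) :
    ∫⁻ z, f z * fullTurn (fun θ => r (T θ z)) (fun θ => g (T θ z)) n ∂m =
      ∫⁻ z, g z * fullTurn (fun θ => r (T θ z)) (fun θ => f (T θ z)) n ∂m := by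
  have hzero : ∀ z, T 0 z = z := fun z => by
    conv_lhs => rw [← hper z, ← hadd, zero_add, hper]
  have hcan : ∀ u z, T u (T (-u) z) = z := fun u z => by rw [← hadd, add_neg_cancel, hzero]
  have hcomp : ∀ {k : Z → ℝ≥0∞}, Measurable k →
      Measurable (Function.uncurry fun z θ => k (T θ z)) := fun hk =>
    (hk.comp hT).comp measurable_swap
  have hneg : Measurable fun q : ℝ × Z => T (-q.1) q.2 :=
    hT.comp (f := fun q : ℝ × Z => (-q.1, q.2)) (by fun_prop)
  cases n with
  | zero =>
    simp only [fullTurn]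
    have hmeas : ∀ k : Z → ℝ≥0∞, Measurable k → ∀ z, Measurable fun θ => k (T θ z) :=
      fun k hk z => (hcomp hk).comp (f := fun θ : ℝ => (z, θ)) (by fun_prop)
    calc ∫⁻ z, f z * ∫⁻ u, g (T u z) ∂unif 0 (2 * Real.pi) ∂m
        = ∫⁻ u, ∫⁻ z, f z * g (T u z) ∂m ∂unif 0 (2 * Real.pi) := by
          rw [← lintegral_lintegral_swap]
          · exact lintegral_congr fun z => (lintegral_const_mul _ (hmeas g hg z)).symm
          · exact ((hf.comp measurable_fst).mul (hcomp hg)).aemeasurable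
      _ = ∫⁻ u, ∫⁻ z, g z * f (T (-u) z) ∂m ∂unif 0 (2 * Real.pi) := by
          refine lintegral_congr fun u => ?_
          rw [← (hm (-u)).lintegral_comp]
          · simp only [hcan, mul_comm]
          · exact hf.mul (hg.comp (hT.comp (f := fun z : Z => (u, z)) (by fun_prop)))
      _ = ∫⁻ z, g z * ∫⁻ u, f (T (-u) z) ∂unif 0 (2 * Real.pi) ∂m := by
          rw [lintegral_lintegral_swap]
          · refine lintegral_congr fun z => lintegral_const_mul _ ?_
            exact (hmeas f hf z).comp measurable_neg
          · exact ((hg.comp measurable_snd).mul (hf.comp hneg)).aemeasurable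
      _ = _ := by
          refine lintegral_congr fun z => ?_
          congr 1
          rw [lintegral_unif_comp_neg (fun u => f (T u z))]
          have hshift := lintegral_unif_comp_add (fun u => f (T u z)) (-(2 * Real.pi)) (-0)
            (2 * Real.pi)
          rw [neg_add_cancel, neg_zero, zero_add] at hshift
          rw [neg_zero, ← hshift]
          simp only [hadd, hper]
  | succ n =>
    have key : ∀ {f g : Z → ℝ≥0∞}, Measurable f → Measurable g →
        ∫⁻ z, f z * fullTurn (fun θ => r (T θ z)) (fun θ => g (T θ z)) (n + 1) ∂m =
          ∫⁻ z, r z * ((ENNReal.ofReal (2 * Real.pi))⁻¹ * ∫⁻ c in Ioo (-(2 * Real.pi)) 0,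
            f (T c z) * retry (fun θ => r (T θ z)) (fun θ => g (T θ z)) c n
              (-(2 * Real.pi)) 0) ∂m := by
      intro f g hf hg
      have hret := measurable_retry (hcomp hr) (hcomp hg) n
      have hm1 : Measurable fun q : Z × ℝ => r (T q.2 q.1) *
          retry (fun θ => r (T θ q.1)) (fun θ => g (T θ q.1)) 0 n (q.2 - 2 * Real.pi) q.2 :=
        (hcomp hr).mul (hret.comp
          (f := fun q : Z × ℝ => (q.1, 0, q.2 - 2 * Real.pi, q.2)) (by fun_prop))
      have hm2 : Measurable fun q : ℝ × Z => f (T (-q.1) q.2) *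
          retry (fun θ => r (T θ q.2)) (fun θ => g (T θ q.2)) (-q.1) n (-(2 * Real.pi)) 0 :=
        (hf.comp hneg).mul (hret.comp
          (f := fun q : ℝ × Z => (q.2, -q.1, -(2 * Real.pi), 0)) (by fun_prop))
      calc ∫⁻ z, f z * fullTurn (fun θ => r (T θ z)) (fun θ => g (T θ z)) (n + 1) ∂m
          = ∫⁻ u, ∫⁻ z, f z * (r (T u z) * retry (fun θ => r (T θ z)) (fun θ => g (T θ z)) 0 n
              (u - 2 * Real.pi) u) ∂m ∂unif 0 (2 * Real.pi) := by
            rw [← lintegral_lintegral_swap]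
            · refine lintegral_congr fun z => ?_
              exact (lintegral_const_mul (f z) (hm1.comp (f := fun u : ℝ => (z, u))
                (by fun_prop))).symm
            · exact ((hf.comp measurable_fst).mul hm1).aemeasurable
        _ = ∫⁻ u, ∫⁻ z, r z * (f (T (-u) z) * retry (fun θ => r (T θ z)) (fun θ => g (T θ z))
              (-u) n (-(2 * Real.pi)) 0) ∂m ∂unif 0 (2 * Real.pi) := by
            refine lintegral_congr fun u => ?_
            rw [← (hm (-u)).lintegral_comp]
            · refine lintegral_congr fun z => ?_
              rw [hcan]
              simp only [← hadd]
              rw [retry_comp_add (fun θ => r (T θ z)) (fun θ => g (T θ z)), zero_add,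
                add_neg_cancel, show u - 2 * Real.pi + -u = -(2 * Real.pi) by ring]
              ring
            · exact hf.mul (hm1.comp (f := fun z : Z => (z, u)) (by fun_prop))
        _ = _ := by
            rw [lintegral_lintegral_swap]
            · refine lintegral_congr fun z => ?_
              have hz := hm2.comp (f := fun u : ℝ => (u, z)) (by fun_prop)
              refine (lintegral_const_mul (r z) hz).trans ?_
              congr 1
              refine (lintegral_unif_comp_neg (fun u => f (T u z) *
                retry (fun θ => r (T θ z)) (fun θ => g (T θ z)) u n (-(2 * Real.pi)) 0) _ _).trans ?_
              rw [lintegral_unif, neg_zero, zero_sub, neg_neg]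
            · exact ((hr.comp measurable_snd).mul hm2).aemeasurable
    rw [key hf hg, key hg hf]
    refine lintegral_congr fun z => ?_
    have hz : ∀ {k : Z → ℝ≥0∞}, Measurable k → Measurable fun θ => k (T θ z) := fun hk =>
      (hcomp hk).comp (f := fun θ : ℝ => (z, θ)) (by fun_prop)
    rw [lintegral_mul_retry_comm (hz hr) (hz hf) (hz hg)]

/-! ### The law of the accepted candidate -/

/-- Integrand that turns the law of the current state of the loop into the integral of `g` against
the law of the candidate drawn after exactly `k` further rejections. -/
def pending (r g : ℝ → ℝ≥0∞) : ℕ → ℝ × ℝ × ℝ → ℝ≥0∞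
  | 0, s => g s.2.2
  | k + 1, s => r s.2.2 * retry r g 0 k (shrunkBracket s).1 (shrunkBracket s).2

lemma measurable_pending {r g : ℝ → ℝ≥0∞} (hr : Measurable r) (hg : Measurable g) (k : ℕ) :
    Measurable (pending r g k) := by
  cases k with
  | zero => exact hg.comp (by fun_prop)
  | succ k =>
    refine (hr.comp (by fun_prop)).mul ?_
    have h := measurable_shrunkBracket
    exact (measurable_retry (Y := ℝ) (r := fun _ => r) (g := fun _ => g)
      (hr.comp measurable_snd) (hg.comp measurable_snd) k).comp
      (f := fun s : ℝ × ℝ × ℝ => (0, 0, (shrunkBracket s).1, (shrunkBracket s).2)) (by fun_prop)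

lemma lintegral_pending_shrinkBody {r g : ℝ → ℝ≥0∞} (hr : Measurable r) (hg : Measurable g)
    (k : ℕ) (s : ℝ × ℝ × ℝ) :
    ∫⁻ s', pending r g k s' ∂shrinkBody s =
      retry r g 0 k (shrunkBracket s).1 (shrunkBracket s).2 := by
  rw [shrinkBody, lintegral_map (measurable_pending hr hg k) (by fun_prop)]
  cases k with
  | zero => rfl
  | succ k =>
    rw [retry]
    refine lintegral_congr fun θ => ?_
    simp only [pending]
    rw [shrunkBracket]
    split_ifs <;> rfl

lemma lintegral_pending_shrinkRun {S : Set ℝ} (hS : MeasurableSet S) {g : ℝ → ℝ≥0∞}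
    (hg : Measurable g) (n k : ℕ) :
    ∫⁻ s, pending (Sᶜ.indicator 1) g k s ∂shrinkRun S n =
      ∫⁻ s, pending (Sᶜ.indicator 1) g (k + n) s ∂shrinkInit := by
  have hr : Measurable (Sᶜ.indicator (1 : ℝ → ℝ≥0∞)) := measurable_one.indicator hS.compl
  have hrej : MeasurableSet {s : ℝ × ℝ × ℝ | s.2.2 ∉ S} :=
    (show Measurable fun s : ℝ × ℝ × ℝ => s.2.2 by fun_prop) hS.compl
  induction n generalizing k with
  | zero => rfl
  | succ n ih =>
    rw [show k + (n + 1) = k + 1 + n by ring, ← ih, shrinkRun,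
      Measure.lintegral_bind measurable_shrinkBody.aemeasurable
        (measurable_pending hr hg k).aemeasurable,
      ← lintegral_indicator hrej]
    refine lintegral_congr fun s => ?_
    by_cases hs : s.2.2 ∈ S
    · rw [indicator_of_notMem (by simpa using hs)]
      simp [pending, hs]
    · rw [indicator_of_mem (show s ∈ {s : ℝ × ℝ × ℝ | s.2.2 ∉ S} from hs),
        lintegral_pending_shrinkBody hr hg]
      simp [pending, hs]

lemma lintegral_pending_shrinkInit {r g : ℝ → ℝ≥0∞} (hr : Measurable r) (hg : Measurable g)
    (n : ℕ) : ∫⁻ s, pending r g n s ∂shrinkInit = fullTurn r g n := by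
  rw [shrinkInit, lintegral_map (measurable_pending hr hg n) (by fun_prop)]
  cases n with
  | zero => rfl
  | succ n =>
    refine lintegral_congr_ae ?_
    filter_upwards [ae_unif_mem_Ioo 0 (2 * Real.pi)] with θ hθ
    simp only [pending, shrunkBracket, if_neg hθ.1.not_gt]

/-- A `2π`-periodic integrand does not see the reduction modulo `2π` of the accepted candidate. -/
lemma lintegral_shrinkLaw {S : Set ℝ} (hS : MeasurableSet S) {h : ℝ → ℝ≥0∞} (hh : Measurable h)
    (hper : Function.Periodic h (2 * Real.pi)) :
    ∫⁻ θ in Ico 0 (2 * Real.pi), h θ ∂shrinkLaw S =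
      ∑' n, fullTurn (Sᶜ.indicator 1) (S.indicator h) n := by
  have hr : Measurable (Sᶜ.indicator (1 : ℝ → ℝ≥0∞)) := measurable_one.indicator hS.compl
  have hmod : Measurable fun s : ℝ × ℝ × ℝ => toIcoMod Real.two_pi_pos 0 s.2.2 :=
    by simp_rw [toIcoMod_eq_add_fract_mul]; fun_prop
  have hacc : MeasurableSet {s : ℝ × ℝ × ℝ | s.2.2 ∈ S} :=
    (show Measurable fun s : ℝ × ℝ × ℝ => s.2.2 by fun_prop) hS
  rw [shrinkLaw, Measure.restrict_sum _ measurableSet_Ico, lintegral_sum_measure]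
  refine tsum_congr fun n => ?_
  rw [← lintegral_pending_shrinkInit hr (hh.indicator hS), ← zero_add n,
    ← lintegral_pending_shrinkRun hS (hh.indicator hS), zero_add,
    ← lintegral_indicator measurableSet_Ico, lintegral_map (hh.indicator measurableSet_Ico) hmod,
    ← lintegral_indicator hacc]
  refine lintegral_congr fun s => ?_
  have hmem : toIcoMod Real.two_pi_pos 0 s.2.2 ∈ Ico 0 (2 * Real.pi) := by
    simpa using toIcoMod_mem_Ico Real.two_pi_pos 0 s.2.2
  have hval : h (toIcoMod Real.two_pi_pos 0 s.2.2) = h s.2.2 := by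
    rw [toIcoMod, hper.sub_zsmul_eq]
  simp only [pending, indicator, mem_ofPred_eq, hmem, if_true, hval]

/-! ### Almost sure termination -/

lemma retry_add {r g₁ g₂ : ℝ → ℝ≥0∞} (hr : Measurable r) (hg₁ : Measurable g₁)
    (c : ℝ) (n : ℕ) (a b : ℝ) :
    retry r (fun θ => g₁ θ + g₂ θ) c n a b = retry r g₁ c n a b + retry r g₂ c n a b := by
  induction n generalizing a b with
  | zero => exact lintegral_add_left hg₁ _
  | succ n ih =>
    have hmeas : Measurable fun q : ℝ × ℝ × ℝ × ℝ => retry r g₁ q.2.1 n q.2.2.1 q.2.2.2 :=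
      measurable_retry (Y := ℝ) (r := fun _ => r) (g := fun _ => g₁)
        (hr.comp measurable_snd) (hg₁.comp measurable_snd) n
    simp only [retry]
    rw [← lintegral_add_left]
    · refine lintegral_congr fun θ => ?_
      simp only [ih]
      split_ifs <;> ring
    · refine hr.mul (Measurable.ite (measurableSet_lt measurable_id measurable_const) ?_ ?_)
      · exact hmeas.comp (f := fun θ : ℝ => (0, c, θ, b)) (by fun_prop)
      · exact hmeas.comp (f := fun θ : ℝ => (0, c, a, θ)) (by fun_prop)

lemma fullTurn_add {r g₁ g₂ : ℝ → ℝ≥0∞} (hr : Measurable r) (hg₁ : Measurable g₁)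
    (n : ℕ) :
    fullTurn r (fun θ => g₁ θ + g₂ θ) n = fullTurn r g₁ n + fullTurn r g₂ n := by
  cases n with
  | zero => exact lintegral_add_left hg₁ _
  | succ n =>
    have hmeas : Measurable fun q : ℝ × ℝ × ℝ × ℝ => retry r g₁ q.2.1 n q.2.2.1 q.2.2.2 :=
      measurable_retry (Y := ℝ) (r := fun _ => r) (g := fun _ => g₁)
        (hr.comp measurable_snd) (hg₁.comp measurable_snd) n
    simp only [fullTurn]
    rw [← lintegral_add_left]
    · refine lintegral_congr fun θ => ?_
      rw [retry_add hr hg₁, mul_add]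
    · exact hr.mul (hmeas.comp (f := fun θ : ℝ => (0, 0, θ - 2 * Real.pi, θ)) (by fun_prop))

/-- A candidate is rejected exactly when one more candidate has to be drawn. -/
lemma retry_self {r : ℝ → ℝ≥0∞} {c : ℝ} (hrc : r c = 0) (n : ℕ) {a b : ℝ} (hac : a < c)
    (hcb : c < b) : retry r r c n a b = retry r (fun _ => 1) c (n + 1) a b := by
  induction n generalizing a b with
  | zero =>
    simp only [retry]
    refine lintegral_congr_ae ?_
    filter_upwards [ae_unif_mem_Ioo a b] with θ hθ
    simp only [lintegral_one, unif_univ hθ.1, unif_univ hθ.2, ite_self, mul_one]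
  | succ n ih =>
    rw [retry, retry]
    refine lintegral_congr_ae ?_
    filter_upwards [ae_unif_mem_Ioo a b] with θ hθ
    rcases lt_trichotomy θ c with h | rfl | h
    · rw [if_pos h, if_pos h, ih h hcb]
    · simp [hrc]
    · rw [if_neg h.not_gt, if_neg h.not_gt, ih hac h]

/-- The version of `retry_self` for the whole circle. -/
lemma fullTurn_self {r : ℝ → ℝ≥0∞} (hr0 : r 0 = 0) (n : ℕ) :
    fullTurn r r n = fullTurn r (fun _ => 1) (n + 1) := by
  cases n with
  | zero =>
    simp only [fullTurn, retry]
    refine lintegral_congr fun θ => ?_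
    rw [lintegral_one, unif_univ (by linarith [Real.pi_pos]), mul_one]
  | succ n =>
    simp only [fullTurn]
    refine lintegral_congr_ae ?_
    filter_upwards [ae_unif_mem_Ioo 0 (2 * Real.pi)] with θ hθ
    rw [retry_self hr0 n (by linarith [hθ.2]) hθ.1]

lemma lintegral_unif_le_of_eq_zero {r : ℝ → ℝ≥0∞} {ε a b : ℝ} (hr1 : ∀ θ, r θ ≤ 1)
    (hε : 0 < ε) (hr0 : ∀ θ ∈ Ioo (-ε) ε, r θ = 0) (ha : a ≤ -ε) (hb : ε ≤ b)
    (hab : b - a ≤ 2 * Real.pi) :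
    ∫⁻ θ, r θ ∂unif a b ≤ ENNReal.ofReal (1 - ε / Real.pi) := by
  have hpos : 0 < b - a := by linarith
  have hle : ∫⁻ θ in Ioo a b, r θ ≤ volume (Ioo a b \ Ioo (-ε) ε) := by
    rw [← lintegral_indicator_one (measurableSet_Ioo.diff measurableSet_Ioo),
      ← lintegral_indicator measurableSet_Ioo]
    refine lintegral_mono fun θ => ?_
    by_cases h : θ ∈ Ioo (-ε) ε
    · simp [indicator, hr0 θ h]
    · by_cases h' : θ ∈ Ioo a b
      · have hd : θ ∈ Ioo a b \ Ioo (-ε) ε := ⟨h', h⟩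
        rw [indicator_of_mem h', indicator_of_mem hd]
        exact hr1 θ
      · simp [indicator_of_notMem h']
  rw [measure_sdiff (Ioo_subset_Ioo ha hb) measurableSet_Ioo.nullMeasurableSet (by simp),
    Real.volume_Ioo, Real.volume_Ioo, ← ENNReal.ofReal_sub _ (by linarith)] at hle
  rw [lintegral_unif]
  refine (mul_le_mul_right hle _).trans ?_
  rw [← ENNReal.ofReal_inv_of_pos hpos, ← ENNReal.ofReal_mul (inv_nonneg.2 hpos.le)]
  refine ENNReal.ofReal_le_ofReal ?_
  have h1 : (b - a)⁻¹ * (b - a - (ε - -ε)) = 1 - 2 * ε / (b - a) := by field_simp; ring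
  rw [h1]
  have h2 : 2 * ε / (2 * Real.pi) ≤ 2 * ε / (b - a) :=
    div_le_div_of_nonneg_left (by linarith) hpos hab
  rw [mul_div_mul_left _ _ two_ne_zero] at h2
  linarith

/-- While candidates in `(-ε, ε)` are accepted, the bracket keeps containing this interval, and each
candidate is rejected with probability at most `1 - ε / π`. -/
lemma retry_one_le {r : ℝ → ℝ≥0∞} {ε : ℝ} (hr1 : ∀ θ, r θ ≤ 1) (hrm : Measurable r)
    (hε : 0 < ε) (hr0 : ∀ θ ∈ Ioo (-ε) ε, r θ = 0) (n : ℕ) {a b : ℝ} (ha : a ≤ -ε) (hb : ε ≤ b)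
    (hab : b - a ≤ 2 * Real.pi) :
    retry r (fun _ => 1) 0 n a b ≤ ENNReal.ofReal (1 - ε / Real.pi) ^ n := by
  induction n generalizing a b with
  | zero =>
    rw [retry, lintegral_one, unif_univ (by linarith), pow_zero]
  | succ n ih =>
    rw [retry, pow_succ']
    calc _ ≤ ∫⁻ θ, r θ * ENNReal.ofReal (1 - ε / Real.pi) ^ n ∂unif a b := by
          refine lintegral_mono_ae ?_
          filter_upwards [ae_unif_mem_Ioo a b] with θ hθ
          by_cases h : θ ∈ Ioo (-ε) ε
          · simp [hr0 θ h]
          · refine mul_le_mul_right ?_ _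
            rw [mem_Ioo, not_and_or, not_lt, not_lt] at h
            split_ifs with h0
            · refine ih ?_ hb (by linarith [hθ.1])
              rcases h with h | h <;> linarith
            · refine ih ha ?_ (by linarith [hθ.2])
              rcases h with h | h <;> linarith
      _ = (∫⁻ θ, r θ ∂unif a b) * ENNReal.ofReal (1 - ε / Real.pi) ^ n :=
          lintegral_mul_const _ hrm
      _ ≤ _ := by
          gcongr
          exact lintegral_unif_le_of_eq_zero hr1 hε hr0 ha hb hab

lemma fullTurn_one_le {r : ℝ → ℝ≥0∞} {ε : ℝ} (hr1 : ∀ θ, r θ ≤ 1) (hrm : Measurable r)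
    (hper : Function.Periodic r (2 * Real.pi))
    (hε : 0 < ε) (hr0 : ∀ θ ∈ Ioo (-ε) ε, r θ = 0) (n : ℕ) :
    fullTurn r (fun _ => 1) (n + 1) ≤ ENNReal.ofReal (1 - ε / Real.pi) ^ n := by
  rw [fullTurn]
  calc _ ≤ ∫⁻ _, ENNReal.ofReal (1 - ε / Real.pi) ^ n ∂unif 0 (2 * Real.pi) := by
        refine lintegral_mono_ae ?_
        filter_upwards [ae_unif_mem_Ioo 0 (2 * Real.pi)] with θ hθ
        by_cases h : r θ = 0
        · simp [h]
        · refine (mul_le_of_le_one_left' (hr1 θ)).trans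
            (retry_one_le hr1 hrm hε hr0 n ?_ ?_ (by linarith))
          · by_contra! h'
            refine h ?_
            rw [← hper.sub_eq]
            exact hr0 _ ⟨h', by linarith [hθ.2]⟩
          · by_contra! h'
            exact h (hr0 _ ⟨by linarith [hθ.1], h'⟩)
    _ = _ := by rw [lintegral_const, unif_univ Real.two_pi_pos, mul_one]

/-- The shrinkage procedure terminates almost surely as soon as all candidates near the centre are
accepted: the bracket never loses the accepted neighbourhood, so the number of rejections has a
geometric tail. -/
lemma tsum_fullTurn {r g : ℝ → ℝ≥0∞} {ε : ℝ} (hrm : Measurable r) (hgm : Measurable g)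
    (hsum : ∀ θ, g θ + r θ = 1) (hper : Function.Periodic r (2 * Real.pi)) (hε : 0 < ε)
    (hr0 : ∀ θ ∈ Ioo (-ε) ε, r θ = 0) : ∑' n, fullTurn r g n = 1 := by
  have hr1 : ∀ θ, r θ ≤ 1 := fun θ => (hsum θ) ▸ le_add_self
  have hstep : ∀ n, fullTurn r g n + fullTurn r (fun _ => 1) (n + 1) =
      fullTurn r (fun _ => 1) n := fun n => by
    rw [← fullTurn_self (hr0 0 (by simpa using hε)), ← fullTurn_add hrm hgm]
    simp only [hsum]
  have hpart : ∀ N, ∑ n ∈ Finset.range N, fullTurn r g n + fullTurn r (fun _ => 1) N = 1 := by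
    intro N
    induction N with
    | zero => simp [fullTurn, unif_univ Real.two_pi_pos]
    | succ N ih => rw [Finset.sum_range_succ, add_assoc, hstep, ih]
  have hlim : Filter.Tendsto (fun N => fullTurn r (fun _ => 1) N) Filter.atTop (nhds 0) := by
    rw [← Filter.tendsto_add_atTop_iff_nat 1]
    refine tendsto_of_tendsto_of_tendsto_of_le_of_le tendsto_const_nhds
      (ENNReal.tendsto_pow_atTop_nhds_zero_of_lt_one ?_) (fun _ => zero_le)
      (fullTurn_one_le hr1 hrm hper hε hr0)
    rw [ENNReal.ofReal_lt_one]
    have := div_pos hε Real.pi_pos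
    linarith
  have h := (ENNReal.tendsto_nat_tsum (fullTurn r g)).add hlim
  simp only [hpart, add_zero] at h
  exact (tendsto_nhds_unique tendsto_const_nhds h).symm

/-! ### Uniform ergodicity from a minorization -/

lemma kernel_pow_succ_apply {α : Type*} [MeasurableSpace α] (H : Kernel α α) (n : ℕ) (x : α)
    {A : Set α} (hA : MeasurableSet A) : (H ^ (n + 1)) x A = ∫⁻ y, (H ^ n) y A ∂H x := by
  rw [pow_succ, show H ^ n * H = (H ^ n) ∘ₖ H from rfl, Kernel.comp_apply' _ _ _ hA]

lemma isMarkovKernel_pow {α : Type*} [MeasurableSpace α] (H : Kernel α α) [IsMarkovKernel H]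
    (n : ℕ) : IsMarkovKernel (H ^ n) := by
  induction n with
  | zero => exact (inferInstance : IsMarkovKernel (Kernel.id : Kernel α α))
  | succ n ih =>
    rw [pow_succ]
    exact (inferInstance : IsMarkovKernel ((H ^ n) ∘ₖ H))

lemma lintegral_kernel_pow {α : Type*} [MeasurableSpace α] {H : Kernel α α} {μ : Measure α}
    (hinv : μ.bind H = μ) (n : ℕ) {A : Set α} (hA : MeasurableSet A) :
    ∫⁻ x, (H ^ n) x A ∂μ = μ A := by
  induction n with
  | zero =>
    rw [pow_zero, show (1 : Kernel α α) = Kernel.id from rfl]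
    simp only [Kernel.id_apply]
    rw [← Measure.bind_apply hA Measure.measurable_dirac.aemeasurable, Measure.bind_dirac]
  | succ n ih =>
    simp only [kernel_pow_succ_apply H n _ hA]
    rw [← Measure.lintegral_bind H.aemeasurable ((H ^ n).measurable_coe hA).aemeasurable, hinv, ih]

/-- Each step of the chain shrinks the range of `x ↦ Hⁿ(x, A)` by the mass that the minorization
leaves over. -/
lemma exists_pow_apply_mem_Icc {α : Type*} [MeasurableSpace α] {H : Kernel α α}
    [IsMarkovKernel H] {η : Measure α} [IsFiniteMeasure η] (hη : ∀ x, η ≤ H x)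
    (n : ℕ) {A : Set α} (hA : MeasurableSet A) :
    ∃ l : ℝ≥0∞, ∀ x, (H ^ n) x A ∈ Icc l (l + (1 - η univ) ^ n) := by
  induction n with
  | zero =>
    refine ⟨0, fun x => ⟨zero_le, ?_⟩⟩
    have := isMarkovKernel_pow H 0
    rw [zero_add, pow_zero (1 - η univ)]
    exact prob_le_one
  | succ n ih =>
    obtain ⟨l, hl⟩ := ih
    -- the part `η` of `H x` contributes the same amount for every `x`
    refine ⟨∫⁻ y, (H ^ n) y A ∂η + l * (1 - η univ), fun x => ?_⟩
    have hmass : (H x - η) univ = 1 - η univ := by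
      rw [Measure.sub_apply .univ (hη x), measure_univ]
    have hsplit : (H ^ (n + 1)) x A =
        ∫⁻ y, (H ^ n) y A ∂η + ∫⁻ y, (H ^ n) y A ∂(H x - η) := by
      rw [kernel_pow_succ_apply H n x hA, ← lintegral_add_measure, add_comm η,
        Measure.sub_add_cancel_of_le (hη x)]
    rw [hsplit, ← hmass, ← lintegral_const, add_assoc, pow_succ]
    refine ⟨add_le_add_right (lintegral_mono fun y => (hl y).1) _, add_le_add_right ?_ _⟩
    refine (lintegral_mono fun y => (hl y).2).trans ?_
    rw [lintegral_const, lintegral_const, add_mul, hmass]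

/-- Doeblin's theorem: a chain that dominates `η` from every point converges geometrically in total
variation to its invariant probability measure. -/
theorem dTV_pow_le {α : Type*} [MeasurableSpace α] {H : Kernel α α} [IsMarkovKernel H]
    {η μ : Measure α} [IsFiniteMeasure η] [IsProbabilityMeasure μ] (hη : ∀ x, η ≤ H x)
    (hinv : μ.bind H = μ) (n : ℕ) (x : α) :
    dTV ((H ^ n) x) μ ≤ (1 - η univ) ^ n := by
  refine iSup₂_le fun A hA => ?_
  obtain ⟨l, hl⟩ := exists_pow_apply_mem_Icc hη n hA
  have := isMarkovKernel_pow H n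
  have hμ : μ A ∈ Icc l (l + (1 - η univ) ^ n) := by
    rw [← lintegral_kernel_pow hinv n hA]
    constructor
    · calc l = ∫⁻ _, l ∂μ := by simp
        _ ≤ _ := lintegral_mono fun y => (hl y).1
    · calc _ ≤ ∫⁻ _, (l + (1 - η univ) ^ n) ∂μ := lintegral_mono fun y => (hl y).2
        _ = _ := by simp
  have hD : (1 - η univ) ^ n ≠ ∞ := ENNReal.pow_ne_top (by simp)
  have hltop : l ≠ ∞ := ne_top_of_le_ne_top (measure_ne_top μ A) hμ.1
  obtain ⟨h1, h2⟩ := hl x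
  obtain ⟨h3, h4⟩ := hμ
  rw [← ENNReal.toReal_le_toReal hltop (measure_ne_top _ _)] at h1 h3
  rw [← ENNReal.toReal_le_toReal (measure_ne_top _ _) (by finiteness),
    ENNReal.toReal_add hltop hD] at h2 h4
  rw [ENNReal.ofReal_le_iff_le_toReal hD, abs_le]
  simp only [Measure.real]
  constructor <;> linarith

/-! ### Integration over spheres -/

section Surface

lemma measurableSet_punctured_ball {F : Type*} [NormedAddCommGroup F] [MeasurableSpace F]
    [BorelSpace F] : MeasurableSet {y : F | 0 < ‖y‖ ∧ ‖y‖ < 1} :=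
  (measurableSet_lt measurable_const measurable_norm).inter
    (measurableSet_lt measurable_norm measurable_const)

variable {F : Type*} [NormedAddCommGroup F] [InnerProductSpace ℝ F] [FiniteDimensional ℝ F]
  [MeasurableSpace F] [BorelSpace F]

instance : IsFiniteMeasure (surface F) := by unfold surface; infer_instance

lemma lintegral_surface {g : F → ℝ≥0∞} (hg : Measurable g) :
    ∫⁻ v, g v ∂surface F =
      Module.finrank ℝ F * ∫⁻ y in {y : F | 0 < ‖y‖ ∧ ‖y‖ < 1}, g (‖y‖⁻¹ • y) := by
  have hnorm : Measurable fun y : F => ‖y‖⁻¹ • y := by fun_prop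
  have key : (surface F).map Subtype.val = (Module.finrank ℝ F : ℝ≥0∞) •
      (volume.restrict {y : F | 0 < ‖y‖ ∧ ‖y‖ < 1}).map fun y => ‖y‖⁻¹ • y := by
    ext A hA
    rw [Measure.map_apply measurable_subtype_coe hA, surface,
      Measure.toSphere_apply' _ (measurable_subtype_coe hA), Measure.smul_apply, smul_eq_mul,
      Measure.map_apply hnorm hA, Measure.restrict_apply (hnorm hA)]
    congr 2
    ext y
    simp only [Set.mem_smul, mem_image, mem_preimage, mem_inter_iff, mem_ofPred_eq]
    constructor
    · rintro ⟨r, hr, _, ⟨v, hv, rfl⟩, rfl⟩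
      have hn : ‖r • (v : F)‖ = r := by
        rw [norm_smul, mem_sphere_zero_iff_norm.1 v.2, mul_one, Real.norm_of_nonneg hr.1.le]
      rw [hn, smul_smul, inv_mul_cancel₀ hr.1.ne', one_smul]
      exact ⟨hv, hr⟩
    · rintro ⟨hA, h0, h1⟩
      refine ⟨‖y‖, ⟨h0, h1⟩, ‖y‖⁻¹ • y, ⟨⟨‖y‖⁻¹ • y, ?_⟩, hA, rfl⟩, ?_⟩
      · rw [mem_sphere_zero_iff_norm, norm_smul, norm_inv, norm_norm, inv_mul_cancel₀ h0.ne']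
      · rw [smul_smul, mul_inv_cancel₀ h0.ne', one_smul]
  rw [← lintegral_map hg measurable_subtype_coe, key, lintegral_smul_measure,
    lintegral_map hg hnorm, smul_eq_mul]

/-- Polar coordinates around the origin. -/
lemma lintegral_eq_lintegral_surface [Nontrivial F] {h : F → ℝ≥0∞} (hh : Measurable h) :
    ∫⁻ w, h w = ∫⁻ v, ∫⁻ r in Ioi (0 : ℝ),
      ENNReal.ofReal (r ^ (Module.finrank ℝ F - 1)) * h (r • (v : F))
        ∂volume ∂surface F := by
  have hmp := (volume : Measure F).measurePreserving_homeomorphUnitSphereProd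
  have hk : Measurable fun q : ↥(Metric.sphere (0 : F) 1) × Ioi (0 : ℝ) =>
      h (q.2.1 • (q.1 : F)) := hh.comp (by fun_prop)
  calc ∫⁻ w, h w = ∫⁻ w in ({0}ᶜ : Set F), h w := by
        rw [restrict_compl_singleton]
    _ = ∫⁻ w : ({0}ᶜ : Set F), h w ∂(volume.comap Subtype.val) :=
        (lintegral_subtype_comap (measurableSet_singleton _).compl h).symm
    _ = ∫⁻ w : ({0}ᶜ : Set F), (fun q : ↥(Metric.sphere (0 : F) 1) × Ioi (0 : ℝ) =>
          h (q.2.1 • (q.1 : F))) (homeomorphUnitSphereProd F w) ∂(volume.comap Subtype.val) := by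
        refine lintegral_congr fun w => ?_
        have hw : ‖(w : F)‖ ≠ 0 := norm_ne_zero_iff.2 w.2
        simp [smul_smul, mul_inv_cancel₀ hw]
    _ = ∫⁻ v, ∫⁻ r, h (r.1 • (v : F)) ∂Measure.volumeIoiPow (Module.finrank ℝ F - 1)
          ∂surface F := by
        rw [hmp.lintegral_comp hk, lintegral_prod _ hk.aemeasurable]
        rfl
    _ = _ := by
        refine lintegral_congr fun v => ?_
        have hv : Measurable fun r : Ioi (0 : ℝ) => h (r.1 • (v : F)) := hh.comp (by fun_prop)
        rw [Measure.volumeIoiPow, lintegral_withDensity_eq_lintegral_mul _ (by fun_prop) hv]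
        exact lintegral_subtype_comap measurableSet_Ioi
          (fun r : ℝ => ENNReal.ofReal (r ^ (Module.finrank ℝ F - 1)) * h (r • (v : F)))

end Surface

variable {d : ℕ}

lemma norm_coe_sph (x : Sph d) : ‖(x : EuclideanSpace ℝ (Fin d))‖ = 1 :=
  mem_sphere_zero_iff_norm.1 x.2

/-- Fubini's theorem for the decomposition of the ambient space along `x`. -/
lemma lintegral_eq_lintegral_tangent (x : Sph d) {h : EuclideanSpace ℝ (Fin d) → ℝ≥0∞}
    (hh : Measurable h) :
    ∫⁻ y, h y = ∫⁻ s : ℝ, ∫⁻ w : Tangent x, h (s • (x : EuclideanSpace ℝ (Fin d)) + w) := by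
  let K := Submodule.span ℝ {(x : EuclideanSpace ℝ (Fin d))}
  let e := LinearIsometryEquiv.toSpanUnitSingleton (𝕜 := ℝ) (x : EuclideanSpace ℝ (Fin d))
    (norm_coe_sph x)
  have h1 : MeasurePreserving (fun q : ℝ × Tangent x => (e q.1, q.2))
      (volume.prod volume) (volume.prod volume) :=
    e.measurePreserving.prod (MeasurePreserving.id volume)
  have h2 := (K.orthogonalDecomposition.symm.measurePreserving).comp
    ((WithLp.volume_preserving_toLp K Kᗮ).comp h1)
  have hm : Measurable fun q : ℝ × Tangent x =>
      h (q.1 • (x : EuclideanSpace ℝ (Fin d)) + q.2) := hh.comp (by fun_prop)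
  rw [← h2.lintegral_comp hh, ← lintegral_prod _ hm.aemeasurable]
  refine lintegral_congr fun q => ?_
  simp [e]

lemma inner_tangent (x : Sph d) (w : Tangent x) :
    ⟪(x : EuclideanSpace ℝ (Fin d)), (w : EuclideanSpace ℝ (Fin d))⟫ = 0 :=
  Submodule.mem_orthogonal_singleton_iff_inner_right.1 w.2

lemma finrank_tangent (x : Sph d) : Module.finrank ℝ (Tangent x) = d - 1 := by
  have h := Submodule.finrank_add_finrank_orthogonal
    (Submodule.span ℝ {(x : EuclideanSpace ℝ (Fin d))})
  rw [finrank_span_singleton (ne_zero_of_norm_ne_zero (by simp)),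
    finrank_euclideanSpace_fin] at h
  exact Nat.eq_sub_of_add_eq' h

lemma tangentSigma_univ (x : Sph d) : tangentSigma x univ = sigma (d - 1) univ := by
  let e := ((stdOrthonormalBasis ℝ (Tangent x)).reindex (finCongr (finrank_tangent x))).repr
  rw [tangentSigma, sigma, surface, surface, Measure.toSphere_apply_univ,
    Measure.toSphere_apply_univ, finrank_tangent x, finrank_euclideanSpace_fin,
    ← e.measurePreserving.measure_preimage measurableSet_ball.nullMeasurableSet,
    e.preimage_ball, map_zero]

/-- The component of `y` orthogonal to the unit vector `x`. -/
def tangentPart (x y : EuclideanSpace ℝ (Fin d)) : EuclideanSpace ℝ (Fin d) := y - ⟪x, y⟫ • x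

/-- Indicator function of the cylinder over the punctured unit ball of the tangent space at `x`. The
cylinder has height one, so integrals over it of functions of the tangential component are
integrals over that ball. -/
def tangentWeight (x y : EuclideanSpace ℝ (Fin d)) : ℝ≥0∞ :=
  {y | |⟪x, y⟫| < 1 / 2 ∧ 0 < ‖tangentPart x y‖ ∧ ‖tangentPart x y‖ < 1}.indicator 1 y

section Measurability

variable {Y : Type*} [MeasurableSpace Y] {a b : Y → EuclideanSpace ℝ (Fin d)}

lemma measurable_tangentPart (ha : Measurable a) (hb : Measurable b) :
    Measurable fun y => tangentPart (a y) (b y) := by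
  unfold tangentPart; fun_prop

lemma measurable_normalized_tangentPart (ha : Measurable a) (hb : Measurable b) :
    Measurable fun y => ‖tangentPart (a y) (b y)‖⁻¹ • tangentPart (a y) (b y) :=
  (measurable_tangentPart ha hb).norm.inv.smul (measurable_tangentPart ha hb)

lemma measurable_tangentWeight (ha : Measurable a) (hb : Measurable b) :
    Measurable fun y => tangentWeight (a y) (b y) := by
  have hn := (measurable_tangentPart ha hb).norm
  have hi : Measurable fun y => |⟪a y, b y⟫| := by fun_prop
  have hS : MeasurableSet {y | |⟪a y, b y⟫| < 1 / 2 ∧ 0 < ‖tangentPart (a y) (b y)‖ ∧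
      ‖tangentPart (a y) (b y)‖ < 1} :=
    (measurableSet_lt hi measurable_const).inter
      ((measurableSet_lt measurable_const hn).inter (measurableSet_lt hn measurable_const))
  have h : Measurable ({y | |⟪a y, b y⟫| < 1 / 2 ∧ 0 < ‖tangentPart (a y) (b y)‖ ∧
      ‖tangentPart (a y) (b y)‖ < 1}.indicator (1 : Y → ℝ≥0∞)) := measurable_one.indicator hS
  exact h

end Measurability

/-- The surface measure of the great subsphere with pole `x` as an integral over the ambient space:
in this form the dependence on the pole is explicit. -/
lemma lintegral_tangentSigma (x : Sph d) {g : EuclideanSpace ℝ (Fin d) → ℝ≥0∞}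
    (hg : Measurable g) :
    ∫⁻ v, g ((v : Tangent x) : EuclideanSpace ℝ (Fin d)) ∂tangentSigma x =
      ((d - 1 : ℕ) : ℝ≥0∞) * ∫⁻ y, tangentWeight (x : EuclideanSpace ℝ (Fin d)) y *
        g (‖tangentPart (x : EuclideanSpace ℝ (Fin d)) y‖⁻¹ •
          tangentPart (x : EuclideanSpace ℝ (Fin d)) y) := by
  have hi : ∀ (s : ℝ) (w : Tangent x), ⟪(x : EuclideanSpace ℝ (Fin d)),
      s • (x : EuclideanSpace ℝ (Fin d)) + w⟫ = s := fun s w => by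
    rw [inner_add_right, inner_smul_right, inner_tangent, real_inner_self_eq_norm_sq,
      norm_coe_sph]
    ring
  have ht : ∀ (s : ℝ) (w : Tangent x), tangentPart (x : EuclideanSpace ℝ (Fin d))
      (s • (x : EuclideanSpace ℝ (Fin d)) + w) = w := fun s w => by
    rw [tangentPart, hi, add_sub_cancel_left]
  have hgt : Measurable fun w : Tangent x => g w := hg.comp measurable_subtype_coe
  have hm : Measurable fun y : EuclideanSpace ℝ (Fin d) =>
      tangentWeight (x : EuclideanSpace ℝ (Fin d)) y *
        g (‖tangentPart (x : EuclideanSpace ℝ (Fin d)) y‖⁻¹ •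
          tangentPart (x : EuclideanSpace ℝ (Fin d)) y) :=
    (measurable_tangentWeight measurable_const measurable_id).mul
      (hg.comp (measurable_normalized_tangentPart measurable_const measurable_id))
  rw [tangentSigma, lintegral_surface hgt, finrank_tangent, lintegral_eq_lintegral_tangent x hm]
  congr 1
  have hw : ∀ (s : ℝ) (w : Tangent x), tangentWeight (x : EuclideanSpace ℝ (Fin d))
      (s • (x : EuclideanSpace ℝ (Fin d)) + w) =
      (Ioo (-(1 / 2)) (1 / 2)).indicator 1 s *
        {y : Tangent x | 0 < ‖y‖ ∧ ‖y‖ < 1}.indicator 1 w := fun s w => by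
    have hI : s ∈ Ioo (-(1 / 2) : ℝ) (1 / 2) ↔ |s| < 1 / 2 := abs_lt.symm
    simp only [tangentWeight, indicator, mem_ofPred_eq, hi, ht, Submodule.coe_norm, hI,
      Pi.one_apply]
    by_cases h1 : |s| < 1 / 2
    · simp only [h1, true_and, if_true, one_mul]
      congr
    · simp only [h1, false_and, if_false, zero_mul]
  simp only [hw, ht, mul_assoc]
  have hw' : ∀ w : Tangent x, {y : Tangent x | 0 < ‖y‖ ∧ ‖y‖ < 1}.indicator 1 w *
      g (‖(w : EuclideanSpace ℝ (Fin d))‖⁻¹ • (w : EuclideanSpace ℝ (Fin d))) =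
      {y : Tangent x | 0 < ‖y‖ ∧ ‖y‖ < 1}.indicator (fun w => g ((‖w‖⁻¹ • w : Tangent x))) w := by
    intro w
    by_cases h : w ∈ {y : Tangent x | 0 < ‖y‖ ∧ ‖y‖ < 1}
    · rw [indicator_of_mem h, indicator_of_mem h, Pi.one_apply, one_mul, Submodule.coe_smul,
        Submodule.coe_norm]
    · rw [indicator_of_notMem h, indicator_of_notMem h, zero_mul]
  simp only [hw']
  have hm2 : Measurable ({y : Tangent x | 0 < ‖y‖ ∧ ‖y‖ < 1}.indicator
      (fun w => g ((‖w‖⁻¹ • w : Tangent x)))) :=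
    Measurable.indicator (hgt.comp (measurable_norm.inv.smul measurable_id))
      measurableSet_punctured_ball
  simp_rw [lintegral_const_mul _ hm2]
  rw [lintegral_mul_const _ (measurable_one.indicator measurableSet_Ioo),
    lintegral_indicator_one measurableSet_Ioo, Real.volume_Ioo,
    lintegral_indicator measurableSet_punctured_ball]
  norm_num

/-! ### Geodesic polar coordinates -/

lemma inner_unitTangent (x : Sph d) (v : UnitTangent x) :
    ⟪(x : EuclideanSpace ℝ (Fin d)), ((v : Tangent x) : EuclideanSpace ℝ (Fin d))⟫ = 0 :=
  inner_tangent x v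

lemma norm_unitTangent (x : Sph d) (v : UnitTangent x) :
    ‖((v : Tangent x) : EuclideanSpace ℝ (Fin d))‖ = 1 := by
  have h := mem_sphere_zero_iff_norm.1 v.2
  rwa [Submodule.coe_norm] at h

lemma coe_geodesic (x : Sph d) (v : UnitTangent x) (θ : ℝ) :
    (geodesic x v θ : EuclideanSpace ℝ (Fin d)) =
      Real.cos θ • (x : EuclideanSpace ℝ (Fin d)) +
        Real.sin θ • ((v : Tangent x) : EuclideanSpace ℝ (Fin d)) := rfl

lemma lintegral_Ioo_pow (n : ℕ) :
    ∫⁻ r in Ioo (0 : ℝ) 1, ENNReal.ofReal (r ^ n) = ((n + 1 : ℕ) : ℝ≥0∞)⁻¹ := by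
  rw [Measure.restrict_congr_set Ioo_ae_eq_Ioc, ← ofReal_integral_eq_lintegral_ofReal,
    ← intervalIntegral.integral_of_le zero_le_one, integral_pow]
  · rw [one_pow, zero_pow n.succ_ne_zero, sub_zero, one_div,
      ENNReal.ofReal_inv_of_pos (by positivity)]
    norm_cast
  · exact (intervalIntegral.intervalIntegrable_pow n).1
  · filter_upwards [ae_restrict_mem measurableSet_Ioc] with y hy
    exact pow_nonneg hy.1.le _

/-- The integrand of `lintegral_sigma_le` in planar coordinates, after the substitution
`(s, u) = (r cos θ, r sin θ)`. -/
lemma planar_integrand_le (x : Sph d) (v : UnitTangent x) (hd : 2 ≤ d)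
    (f : EuclideanSpace ℝ (Fin d) → ℝ≥0∞) {r θ : ℝ} (hr : 0 < r) (hθ : θ ∈ Ioo (-Real.pi) Real.pi) :
    ENNReal.ofReal r * (Ioi (0 : ℝ)).indicator (fun u => ENNReal.ofReal (u ^ (d - 1 - 1)) *
      {y : EuclideanSpace ℝ (Fin d) | 0 < ‖y‖ ∧ ‖y‖ < 1}.indicator (fun y => f (‖y‖⁻¹ • y))
        ((r * Real.cos θ) • (x : EuclideanSpace ℝ (Fin d)) +
          u • ((v : Tangent x) : EuclideanSpace ℝ (Fin d)))) (r * Real.sin θ) ≤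
      (Ioo (0 : ℝ) 1).indicator (fun r => ENNReal.ofReal (r ^ (d - 1))) r *
        (Ioo 0 Real.pi).indicator (fun θ => f (geodesic x v θ)) θ := by
  by_cases hs : 0 < r * Real.sin θ
  swap
  · rw [indicator_of_notMem (by simpa using hs), mul_zero]; exact zero_le
  have hsin : 0 < Real.sin θ := pos_of_mul_pos_right hs hr.le
  have hθ0 : 0 < θ := by
    by_contra! h
    exact hsin.not_ge (Real.sin_nonpos_of_nonpos_of_neg_pi_le h hθ.1.le)
  have hy : (r * Real.cos θ) • (x : EuclideanSpace ℝ (Fin d)) +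
      (r * Real.sin θ) • ((v : Tangent x) : EuclideanSpace ℝ (Fin d)) =
      r • (geodesic x v θ : EuclideanSpace ℝ (Fin d)) := by
    rw [coe_geodesic, smul_add, smul_smul, smul_smul]
  have hn : ‖r • (geodesic x v θ : EuclideanSpace ℝ (Fin d))‖ = r := by
    rw [norm_smul, norm_coe_sph, mul_one, Real.norm_of_nonneg hr.le]
  have hθm : θ ∈ Ioo 0 Real.pi := ⟨hθ0, hθ.2⟩
  rw [indicator_of_mem (show r * Real.sin θ ∈ Ioi 0 from hs), hy, indicator_of_mem hθm]
  by_cases h1 : r < 1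
  swap
  · rw [indicator_of_notMem (by rw [mem_ofPred_eq, hn]; tauto), mul_zero, mul_zero]
    exact zero_le
  have hrm : r ∈ Ioo (0 : ℝ) 1 := ⟨hr, h1⟩
  rw [indicator_of_mem (by rw [mem_ofPred_eq, hn]; exact hrm), indicator_of_mem hrm, hn,
    smul_smul, inv_mul_cancel₀ hr.ne', one_smul, ← mul_assoc, ← ENNReal.ofReal_mul hr.le]
  gcongr
  calc r * (r * Real.sin θ) ^ (d - 1 - 1) ≤ r * r ^ (d - 1 - 1) := by
        gcongr
        exact mul_le_of_le_one_right hr.le (Real.sin_le_one θ)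
    _ = r ^ (d - 1) := by rw [← pow_succ']; congr 1; omega

/-- Polar coordinates on the sphere around `x`, in which the surface measure has the density
`sin ^ (d - 2) θ ≤ 1` with respect to `dθ μ_x(dv)`. -/
lemma lintegral_sigma_le (x : Sph d) (hd : 2 ≤ d) {f : EuclideanSpace ℝ (Fin d) → ℝ≥0∞}
    (hf : Measurable f) :
    ∫⁻ y, f y ∂sigma d ≤
      ∫⁻ v, ∫⁻ θ in Ioo 0 Real.pi, f (geodesic x v θ) ∂volume ∂tangentSigma x := by
  have : Nontrivial (Tangent x) := by
    apply Module.nontrivial_of_finrank_pos (R := ℝ)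
    rw [finrank_tangent]; omega
  have hB : MeasurableSet {y : EuclideanSpace ℝ (Fin d) | 0 < ‖y‖ ∧ ‖y‖ < 1} :=
    measurableSet_punctured_ball
  set h : EuclideanSpace ℝ (Fin d) → ℝ≥0∞ :=
    {y : EuclideanSpace ℝ (Fin d) | 0 < ‖y‖ ∧ ‖y‖ < 1}.indicator (fun y => f (‖y‖⁻¹ • y)) with hh
  have hm : Measurable h := (hf.comp (measurable_norm.inv.smul measurable_id)).indicator hB
  set k : UnitTangent x → ℝ × ℝ → ℝ≥0∞ := fun v p => (Ioi (0 : ℝ)).indicator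
    (fun u => ENNReal.ofReal (u ^ (d - 1 - 1)) * h (p.1 • (x : EuclideanSpace ℝ (Fin d)) +
      u • ((v : Tangent x) : EuclideanSpace ℝ (Fin d)))) p.2 with hk
  have hkm : Measurable (Function.uncurry k) := by
    have h1 : Measurable fun q : UnitTangent x × ℝ × ℝ => ENNReal.ofReal (q.2.2 ^ (d - 1 - 1)) *
        h (q.2.1 • (x : EuclideanSpace ℝ (Fin d)) +
          q.2.2 • ((q.1 : Tangent x) : EuclideanSpace ℝ (Fin d))) :=
      Measurable.mul (by fun_prop) (hm.comp (by fun_prop))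
    have h2 : MeasurableSet {q : UnitTangent x × ℝ × ℝ | q.2.2 ∈ Ioi (0 : ℝ)} :=
      (show Measurable fun q : UnitTangent x × ℝ × ℝ => q.2.2 by fun_prop) measurableSet_Ioi
    exact h1.indicator h2
  have step1 : ∫⁻ y, h y = ∫⁻ v, ∫⁻ p, k v p ∂volume ∂tangentSigma x := by
    rw [lintegral_eq_lintegral_tangent x hm]
    calc _ = ∫⁻ s : ℝ, ∫⁻ v, ∫⁻ u, k v (s, u) ∂volume ∂tangentSigma x := by
          refine lintegral_congr fun s => ?_
          rw [lintegral_eq_lintegral_surface (F := Tangent x)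
            (h := fun w => h (s • (x : EuclideanSpace ℝ (Fin d)) + w)) (hm.comp (by fun_prop)),
            finrank_tangent]
          refine lintegral_congr fun v => ?_
          rw [← lintegral_indicator measurableSet_Ioi]
          rfl
      _ = ∫⁻ v, ∫⁻ s : ℝ, ∫⁻ u, k v (s, u) ∂volume ∂volume ∂tangentSigma x := by
          have : SFinite (tangentSigma x) := by unfold tangentSigma; infer_instance
          rw [lintegral_lintegral_swap]
          have h3 : Measurable fun q : (ℝ × UnitTangent x) × ℝ => k q.1.2 (q.1.1, q.2) :=
            hkm.comp (f := fun q : (ℝ × UnitTangent x) × ℝ => (q.1.2, (q.1.1, q.2)))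
              (by fun_prop)
          exact h3.lintegral_prod_right'.aemeasurable
      _ = _ := by
          refine lintegral_congr fun v => ?_
          rw [Measure.volume_eq_prod, lintegral_prod]
          exact (hkm.comp (f := fun p : ℝ × ℝ => (v, p)) (by fun_prop)).aemeasurable
  have step2 : ∀ v, ∫⁻ p, k v p ≤ ((d : ℕ) : ℝ≥0∞)⁻¹ *
      ∫⁻ θ in Ioo 0 Real.pi, f (geodesic x v θ) := by
    intro v
    have hg : Measurable fun θ : ℝ => f (geodesic x v θ) := by
      simp only [coe_geodesic]
      exact hf.comp (by fun_prop)
    calc ∫⁻ p, k v p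
        = ∫⁻ p in polarCoord.target, ENNReal.ofReal p.1 • k v (polarCoord.symm p) :=
          (lintegral_comp_polarCoord_symm _).symm
      _ ≤ ∫⁻ p in polarCoord.target,
            (Ioo (0 : ℝ) 1).indicator (fun r => ENNReal.ofReal (r ^ (d - 1))) p.1 *
              (Ioo 0 Real.pi).indicator (fun θ => f (geodesic x v θ)) p.2 := by
          refine setLIntegral_mono' polarCoord.open_target.measurableSet fun p hp => ?_
          exact planar_integrand_le x v hd f hp.1 hp.2
      _ ≤ ∫⁻ p : ℝ × ℝ,
            (Ioo (0 : ℝ) 1).indicator (fun r => ENNReal.ofReal (r ^ (d - 1))) p.1 *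
              (Ioo 0 Real.pi).indicator (fun θ => f (geodesic x v θ)) p.2 :=
          setLIntegral_le_lintegral _ _
      _ = _ := by
          have hi1 : Measurable
              ((Ioo (0 : ℝ) 1).indicator (fun r => ENNReal.ofReal (r ^ (d - 1)))) :=
            Measurable.indicator (by fun_prop) measurableSet_Ioo
          rw [Measure.volume_eq_prod, lintegral_prod_mul hi1.aemeasurable
            (hg.indicator measurableSet_Ioo).aemeasurable, lintegral_indicator measurableSet_Ioo,
            lintegral_indicator measurableSet_Ioo, lintegral_Ioo_pow,
            Nat.sub_add_cancel (by omega)]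
  rw [sigma, lintegral_surface hf, finrank_euclideanSpace_fin, ← lintegral_indicator hB, ← hh,
    step1]
  calc _ ≤ (d : ℝ≥0∞) * ∫⁻ v, ((d : ℕ) : ℝ≥0∞)⁻¹ *
        ∫⁻ θ in Ioo 0 Real.pi, f (geodesic x v θ) ∂volume ∂tangentSigma x := by
        gcongr with v
        exact step2 v
    _ = _ := by
        have hd0 : (d : ℝ≥0∞) ≠ 0 := by simp; omega
        rw [lintegral_const_mul', ← mul_assoc, ENNReal.mul_inv_cancel hd0 (by simp), one_mul]
        simpa using hd0

/-! ### Dependence of the great subsphere on the pole -/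

instance (x : Sph d) : IsFiniteMeasure (tangentSigma x) := by unfold tangentSigma; infer_instance

instance : IsFiniteMeasure (sigma d) := by unfold sigma; infer_instance

lemma measurable_lintegral_tangentSigma {Y : Type*} [MeasurableSpace Y] {a : Y → Sph d}
    {F : Y → EuclideanSpace ℝ (Fin d) → ℝ≥0∞} (ha : Measurable a)
    (hF : Measurable (Function.uncurry F)) :
    Measurable fun y =>
      ∫⁻ v, F y ((v : Tangent (a y)) : EuclideanSpace ℝ (Fin d)) ∂tangentSigma (a y) := by
  have hrw : ∀ y, ∫⁻ v, F y ((v : Tangent (a y)) : EuclideanSpace ℝ (Fin d)) ∂tangentSigma (a y) =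
      ((d - 1 : ℕ) : ℝ≥0∞) * ∫⁻ z, tangentWeight (a y : EuclideanSpace ℝ (Fin d)) z *
        F y (‖tangentPart (a y : EuclideanSpace ℝ (Fin d)) z‖⁻¹ •
          tangentPart (a y : EuclideanSpace ℝ (Fin d)) z) := fun y =>
    lintegral_tangentSigma (a y) (hF.comp measurable_prodMk_left)
  simp_rw [hrw]
  have ha' : Measurable fun q : Y × EuclideanSpace ℝ (Fin d) =>
      (a q.1 : EuclideanSpace ℝ (Fin d)) := by fun_prop
  refine Measurable.const_mul ?_ _
  refine Measurable.lintegral_prod_right' (f := fun q : Y × EuclideanSpace ℝ (Fin d) =>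
    tangentWeight (a q.1 : EuclideanSpace ℝ (Fin d)) q.2 *
        F q.1 (‖tangentPart (a q.1 : EuclideanSpace ℝ (Fin d)) q.2‖⁻¹ •
          tangentPart (a q.1 : EuclideanSpace ℝ (Fin d)) q.2)) ?_
  refine (measurable_tangentWeight ha' measurable_snd).mul ?_
  exact hF.comp (measurable_fst.prodMk (measurable_normalized_tangentPart ha' measurable_snd))

lemma lintegral_sigma_comp_isometry (U : EuclideanSpace ℝ (Fin d) ≃ₗᵢ[ℝ] EuclideanSpace ℝ (Fin d))
    {f : EuclideanSpace ℝ (Fin d) → ℝ≥0∞} (hf : Measurable f) :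
    ∫⁻ x, f (U x) ∂sigma d = ∫⁻ x, f x ∂sigma d := by
  have hU : Measurable U := U.continuous.measurable
  have hB : MeasurableSet {y : EuclideanSpace ℝ (Fin d) | 0 < ‖y‖ ∧ ‖y‖ < 1} :=
    measurableSet_punctured_ball
  have hm : Measurable ({y : EuclideanSpace ℝ (Fin d) | 0 < ‖y‖ ∧ ‖y‖ < 1}.indicator
      fun y => f (‖y‖⁻¹ • y)) := (hf.comp (measurable_norm.inv.smul measurable_id)).indicator hB
  rw [sigma, lintegral_surface hf, lintegral_surface (g := fun y => f (U y)) (hf.comp hU),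
    ← lintegral_indicator hB, ← lintegral_indicator hB, ← U.measurePreserving.lintegral_comp hm]
  congr 1
  refine lintegral_congr fun y => ?_
  simp only [indicator, mem_ofPred_eq, U.norm_map, map_smul]

lemma lintegral_tangentSigma_comp_isometry
    (U : EuclideanSpace ℝ (Fin d) ≃ₗᵢ[ℝ] EuclideanSpace ℝ (Fin d)) {x x' : Sph d}
    (hx : (x' : EuclideanSpace ℝ (Fin d)) = U x)
    {g : EuclideanSpace ℝ (Fin d) → ℝ≥0∞} (hg : Measurable g) :
    ∫⁻ v, g (U ((v : Tangent x) : EuclideanSpace ℝ (Fin d))) ∂tangentSigma x =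
      ∫⁻ v, g ((v : Tangent x') : EuclideanSpace ℝ (Fin d)) ∂tangentSigma x' := by
  have hU : Measurable U := U.continuous.measurable
  have hm : Measurable fun y : EuclideanSpace ℝ (Fin d) =>
      tangentWeight (x' : EuclideanSpace ℝ (Fin d)) y *
        g (‖tangentPart (x' : EuclideanSpace ℝ (Fin d)) y‖⁻¹ •
          tangentPart (x' : EuclideanSpace ℝ (Fin d)) y) :=
    (measurable_tangentWeight measurable_const measurable_id).mul
      (hg.comp (measurable_normalized_tangentPart measurable_const measurable_id))
  rw [lintegral_tangentSigma x' hg, lintegral_tangentSigma x (g := fun y => g (U y)) (hg.comp hU),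
    ← U.measurePreserving.lintegral_comp hm]
  congr 1
  refine lintegral_congr fun y => ?_
  have hinner : ⟪(x' : EuclideanSpace ℝ (Fin d)), U y⟫ =
      ⟪(x : EuclideanSpace ℝ (Fin d)), y⟫ := by rw [hx, U.inner_map_map]
  have hpart : tangentPart (x' : EuclideanSpace ℝ (Fin d)) (U y) =
      U (tangentPart (x : EuclideanSpace ℝ (Fin d)) y) := by
    rw [tangentPart, tangentPart, hinner, hx, map_sub, map_smul]
  simp only [tangentWeight, indicator, mem_ofPred_eq, hpart, U.norm_map, map_smul, hinner,
    Pi.one_apply]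

/-! ### The Liouville measure on orthonormal pairs -/

/-- The Liouville measure `σ(dx) μ_x(dv)` of the unit tangent bundle of the sphere, as a measure on
the pairs of vectors of the ambient space. -/
def liouville (d : ℕ) : Measure (EuclideanSpace ℝ (Fin d) × EuclideanSpace ℝ (Fin d)) :=
  (sigma d).bind fun x => (tangentSigma x).map fun v : UnitTangent x =>
    ((x : EuclideanSpace ℝ (Fin d)), ((v : Tangent x) : EuclideanSpace ℝ (Fin d)))

lemma lintegral_liouville
    {F : EuclideanSpace ℝ (Fin d) × EuclideanSpace ℝ (Fin d) → ℝ≥0∞} (hF : Measurable F) :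
    ∫⁻ z, F z ∂liouville d =
      ∫⁻ x, ∫⁻ v, F (↑x, ((v : Tangent x) : _)) ∂tangentSigma x ∂sigma d := by
  have hpair : ∀ x : Sph d, Measurable fun v : UnitTangent x =>
      ((x : EuclideanSpace ℝ (Fin d)), ((v : Tangent x) : EuclideanSpace ℝ (Fin d))) :=
    fun x => by fun_prop
  have hker : Measurable fun x : Sph d => (tangentSigma x).map fun v : UnitTangent x =>
      ((x : EuclideanSpace ℝ (Fin d)), ((v : Tangent x) : EuclideanSpace ℝ (Fin d))) := by
    refine Measure.measurable_of_measurable_coe _ fun A hA => ?_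
    have hrw : ∀ x : Sph d, (tangentSigma x).map (fun v : UnitTangent x => ((x : EuclideanSpace ℝ (Fin d)),
        ((v : Tangent x) : EuclideanSpace ℝ (Fin d)))) A =
        ∫⁻ v, A.indicator 1 ((x : EuclideanSpace ℝ (Fin d)),
          ((v : Tangent x) : EuclideanSpace ℝ (Fin d))) ∂tangentSigma x := fun x => by
      rw [← lintegral_map (f := A.indicator 1) (measurable_one.indicator hA) (hpair x),
        lintegral_indicator_one hA]
    simp_rw [hrw]
    refine measurable_lintegral_tangentSigma (a := fun x : Sph d => x)
      (F := fun x v => A.indicator 1 ((x : EuclideanSpace ℝ (Fin d)), v)) measurable_id ?_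
    exact (measurable_one.indicator hA).comp
      (f := fun q : Sph d × EuclideanSpace ℝ (Fin d) => ((q.1 : EuclideanSpace ℝ (Fin d)), q.2))
      (by fun_prop)
  rw [liouville, Measure.lintegral_bind hker.aemeasurable hF.aemeasurable]
  exact lintegral_congr fun x => lintegral_map hF (hpair x)

lemma liouville_univ : liouville d univ = sigma (d - 1) univ * sigma d univ := by
  rw [← lintegral_one, lintegral_liouville measurable_const]
  simp only [lintegral_one, tangentSigma_univ, lintegral_const]

instance : IsFiniteMeasure (liouville d) where
  measure_univ_lt_top := by
    rw [liouville_univ]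
    exact ENNReal.mul_lt_top (measure_lt_top _ _) (measure_lt_top _ _)

/-- The pair `z` consists of two orthogonal unit vectors. -/
def IsFrame (z : EuclideanSpace ℝ (Fin d) × EuclideanSpace ℝ (Fin d)) : Prop :=
  ‖z.1‖ = 1 ∧ ‖z.2‖ = 1 ∧ ⟪z.1, z.2⟫ = 0

lemma measurableSet_isFrame :
    MeasurableSet {z : EuclideanSpace ℝ (Fin d) × EuclideanSpace ℝ (Fin d) | IsFrame z} :=
  (measurableSet_eq_fun (by fun_prop) (by fun_prop)).inter
    ((measurableSet_eq_fun (by fun_prop) (by fun_prop)).inter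
      (measurableSet_eq_fun (by fun_prop) (by fun_prop)))

lemma ae_isFrame : ∀ᵐ z ∂liouville d, IsFrame z := by
  have hm := (measurableSet_isFrame (d := d)).compl
  rw [ae_iff, show {z : EuclideanSpace ℝ (Fin d) × EuclideanSpace ℝ (Fin d) | ¬IsFrame z} =
    {z | IsFrame z}ᶜ from rfl, ← lintegral_indicator_one hm,
    lintegral_liouville (measurable_one.indicator hm)]
  have hfr : ∀ (x : Sph d) (v : UnitTangent x), IsFrame ((x : EuclideanSpace ℝ (Fin d)),
      ((v : Tangent x) : EuclideanSpace ℝ (Fin d))) := fun x v =>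
    ⟨norm_coe_sph x, norm_unitTangent x v, inner_unitTangent x v⟩
  have h0 : ∀ (x : Sph d) (v : UnitTangent x),
      ({z : EuclideanSpace ℝ (Fin d) × EuclideanSpace ℝ (Fin d) | IsFrame z}ᶜ).indicator
        (1 : EuclideanSpace ℝ (Fin d) × EuclideanSpace ℝ (Fin d) → ℝ≥0∞)
        (↑x, ((v : Tangent x) : _)) = 0 := fun x v =>
    indicator_of_notMem (s := {z | IsFrame z}ᶜ) (fun h => h (hfr x v)) _
  simp only [h0, lintegral_zero]

/-- A right-invariant finite measure on a group determines every invariant measure concentrated on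
one orbit, up to its total mass. -/
lemma measure_mul_eq_of_invariant {G Z : Type*} [Group G] [MeasurableSpace G] [MeasurableMul G]
    [MeasurableSpace Z] {l : Measure G} [IsFiniteMeasure l] [l.IsMulRightInvariant]
    {act : G → Z → Z} (hact : Measurable (Function.uncurry act))
    (hmul : ∀ g h z, act (g * h) z = act g (act h z)) {m : Measure Z} [IsFiniteMeasure m]
    (hm : ∀ g, m.map (act g) = m) {z₀ : Z} (horb : ∀ᵐ z ∂m, ∃ h, act h z₀ = z) {B : Set Z}
    (hB : MeasurableSet B) :
    m B * l univ = m univ * l {g | act g z₀ ∈ B} := by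
  have h1 : Measurable fun q : G × Z => B.indicator (1 : Z → ℝ≥0∞) (act q.1 q.2) :=
    (measurable_one.indicator hB).comp hact
  have hz : ∀ z, Measurable fun g => act g z := fun z =>
    hact.comp (f := fun g : G => (g, z)) (by fun_prop)
  have hg : ∀ g, Measurable (act g) := fun g =>
    hact.comp (f := fun z : Z => (g, z)) (by fun_prop)
  calc m B * l univ = ∫⁻ g, ∫⁻ z, B.indicator (1 : Z → ℝ≥0∞) (act g z) ∂m ∂l := by
        rw [← lintegral_const]
        refine lintegral_congr fun g => ?_
        rw [← lintegral_map (f := B.indicator 1) (measurable_one.indicator hB) (hg g), hm g,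
          lintegral_indicator_one hB]
    _ = ∫⁻ z, ∫⁻ g, B.indicator (1 : Z → ℝ≥0∞) (act g z) ∂l ∂m :=
        lintegral_lintegral_swap h1.aemeasurable
    _ = ∫⁻ _, l {g | act g z₀ ∈ B} ∂m := by
        refine lintegral_congr_ae ?_
        filter_upwards [horb] with z hzo
        obtain ⟨h, rfl⟩ := hzo
        have hset : MeasurableSet {g | act g z₀ ∈ B} := hz z₀ hB
        rw [← measure_preimage_mul_right l h, ← lintegral_indicator_one
          (measurable_mul_const h hset)]
        refine lintegral_congr fun g => ?_
        rw [← hmul]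
        rfl
    _ = _ := by rw [lintegral_const, mul_comm]

/-! ### Invariance under the geodesic flow -/

/-- The orthogonal group of the ambient space. -/
abbrev Orth (d : ℕ) : Type :=
  ↥(unitary (EuclideanSpace ℝ (Fin d) →L[ℝ] EuclideanSpace ℝ (Fin d)))

instance : ContinuousStar (EuclideanSpace ℝ (Fin d) →L[ℝ] EuclideanSpace ℝ (Fin d)) :=
  ⟨(ContinuousLinearMap.adjoint (𝕜 := ℝ) (E := EuclideanSpace ℝ (Fin d))
    (F := EuclideanSpace ℝ (Fin d))).continuous⟩

instance : CompactSpace (Orth d) := by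
  refine isCompact_iff_compactSpace.1 ?_
  have : ProperSpace (EuclideanSpace ℝ (Fin d) →L[ℝ] EuclideanSpace ℝ (Fin d)) :=
    FiniteDimensional.proper ℝ _
  refine (isCompact_closedBall (0 : EuclideanSpace ℝ (Fin d) →L[ℝ] EuclideanSpace ℝ (Fin d))
    1).of_isClosed_subset isClosed_unitary fun u hu => ?_
  rw [mem_closedBall_zero_iff]
  refine ContinuousLinearMap.opNorm_le_bound _ zero_le_one fun y => ?_
  rw [one_mul]
  exact ((Unitary.linearIsometryEquiv ⟨u, hu⟩).norm_map y).le

instance : SecondCountableTopology (Orth d) := by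
  have : ProperSpace (EuclideanSpace ℝ (Fin d) →L[ℝ] EuclideanSpace ℝ (Fin d)) :=
    FiniteDimensional.proper ℝ _
  have : SecondCountableTopology (EuclideanSpace ℝ (Fin d) →L[ℝ] EuclideanSpace ℝ (Fin d)) :=
    secondCountable_of_proper
  infer_instance

/-- The action of the orthogonal group on pairs of vectors. -/
def orthAct (g : Orth d) (z : EuclideanSpace ℝ (Fin d) × EuclideanSpace ℝ (Fin d)) :
    EuclideanSpace ℝ (Fin d) × EuclideanSpace ℝ (Fin d) := (g.1 z.1, g.1 z.2)

lemma measurable_orthAct : Measurable (Function.uncurry (orthAct (d := d))) := by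
  have h : Continuous (Function.uncurry (orthAct (d := d))) := by
    unfold orthAct Function.uncurry
    fun_prop
  exact h.measurable

lemma exists_orthAct_eq (hd : 2 ≤ d)
    {z z' : EuclideanSpace ℝ (Fin d) × EuclideanSpace ℝ (Fin d)} (hz : IsFrame z)
    (hz' : IsFrame z') : ∃ g : Orth d, orthAct g z = z' := by
  have hext : ∀ {z : EuclideanSpace ℝ (Fin d) × EuclideanSpace ℝ (Fin d)}, IsFrame z →
      ∃ b : OrthonormalBasis (Fin d) ℝ (EuclideanSpace ℝ (Fin d)),
        b ⟨0, by omega⟩ = z.1 ∧ b ⟨1, by omega⟩ = z.2 := by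
    intro z hz
    have hne : (⟨1, by omega⟩ : Fin d) ≠ ⟨0, by omega⟩ := by simp
    set i₀ : Fin d := ⟨0, by omega⟩
    set i₁ : Fin d := ⟨1, by omega⟩
    let w : Fin d → EuclideanSpace ℝ (Fin d) := fun i => if i = i₀ then z.1 else z.2
    have hw0 : w i₀ = z.1 := if_pos rfl
    have hw1 : w i₁ = z.2 := if_neg hne
    have hon : Orthonormal ℝ (({i₀, i₁} : Set (Fin d)).domRestrict w) := by
      constructor
      · rintro ⟨i, rfl | rfl⟩
        · simpa [hw0] using hz.1
        · simpa [hw1] using hz.2.1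
      · rintro ⟨i, rfl | rfl⟩ ⟨j, rfl | rfl⟩ hij
        · exact absurd rfl hij
        · simpa [hw0, hw1] using hz.2.2
        · simpa [hw0, hw1, real_inner_comm] using hz.2.2
        · exact absurd rfl hij
    obtain ⟨b, hb⟩ := hon.exists_orthonormalBasis_extension_of_card_eq (by simp)
    exact ⟨b, (hb i₀ (by simp)).trans hw0, (hb i₁ (by simp)).trans hw1⟩
  obtain ⟨b, hb0, hb1⟩ := hext hz
  obtain ⟨b', hb0', hb1'⟩ := hext hz'
  refine ⟨Unitary.linearIsometryEquiv.symm (b.equiv b' (Equiv.refl _)), ?_⟩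
  refine Prod.ext ?_ ?_
  · show b.equiv b' (Equiv.refl _) z.1 = z'.1
    rw [← hb0, ← hb0', OrthonormalBasis.equiv_apply_basis, Equiv.refl_apply]
  · show b.equiv b' (Equiv.refl _) z.2 = z'.2
    rw [← hb1, ← hb1', OrthonormalBasis.equiv_apply_basis, Equiv.refl_apply]

/-- Isometries map the surface measure to itself, and `μ_x` to the corresponding measure at the image
of `x`. -/
lemma map_orthAct_liouville (g : Orth d) : (liouville d).map (orthAct g) = liouville d := by
  have hg : Measurable (orthAct g) := measurable_orthAct.comp measurable_prodMk_left
  let U := Unitary.linearIsometryEquiv g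
  have hU : Measurable U := U.continuous.measurable
  refine Measure.ext_of_lintegral _ fun F hF => ?_
  rw [lintegral_map hF hg, lintegral_liouville (F := fun z => F (orthAct g z)) (hF.comp hg), lintegral_liouville hF]
  -- the inner integral extends to a measurable function of all points of the ambient space
  let f : EuclideanSpace ℝ (Fin d) → ℝ≥0∞ := fun y => ((d - 1 : ℕ) : ℝ≥0∞) *
    ∫⁻ w, tangentWeight y w * F (y, ‖tangentPart y w‖⁻¹ • tangentPart y w)
  have hf : Measurable f := by
    refine Measurable.const_mul (Measurable.lintegral_prod_right'
      (f := fun q : EuclideanSpace ℝ (Fin d) × EuclideanSpace ℝ (Fin d) =>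
        tangentWeight q.1 q.2 * F (q.1, ‖tangentPart q.1 q.2‖⁻¹ • tangentPart q.1 q.2)) ?_) _
    exact (measurable_tangentWeight measurable_fst measurable_snd).mul (hF.comp
      (measurable_fst.prodMk (measurable_normalized_tangentPart measurable_fst measurable_snd)))
  have hfx : ∀ x : Sph d, ∫⁻ v, F ((x : EuclideanSpace ℝ (Fin d)),
      ((v : Tangent x) : EuclideanSpace ℝ (Fin d))) ∂tangentSigma x = f x := fun x =>
    lintegral_tangentSigma x (g := fun v => F (x, v)) (hF.comp measurable_prodMk_left)
  simp only [hfx]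
  rw [← lintegral_sigma_comp_isometry U hf]
  refine lintegral_congr fun x => ?_
  let x' : Sph d := ⟨U x, mem_sphere_zero_iff_norm.2 (by rw [U.norm_map, norm_coe_sph])⟩
  exact (lintegral_tangentSigma_comp_isometry U (x := x) (x' := x') rfl
    (g := fun v => F (x', v)) (hF.comp measurable_prodMk_left)).trans (hfx x')

/-- The geodesic flow of the sphere, extended linearly to all pairs of vectors. -/
def geodesicFlow (θ : ℝ) (z : EuclideanSpace ℝ (Fin d) × EuclideanSpace ℝ (Fin d)) :
    EuclideanSpace ℝ (Fin d) × EuclideanSpace ℝ (Fin d) :=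
  (Real.cos θ • z.1 + Real.sin θ • z.2, -Real.sin θ • z.1 + Real.cos θ • z.2)

lemma measurable_geodesicFlow : Measurable (Function.uncurry (geodesicFlow (d := d))) := by
  unfold geodesicFlow Function.uncurry
  fun_prop

lemma geodesicFlow_add (s u : ℝ) (z : EuclideanSpace ℝ (Fin d) × EuclideanSpace ℝ (Fin d)) :
    geodesicFlow (s + u) z = geodesicFlow s (geodesicFlow u z) := by
  simp only [geodesicFlow, Real.cos_add, Real.sin_add]
  refine Prod.ext ?_ ?_ <;> module

lemma geodesicFlow_two_pi (z : EuclideanSpace ℝ (Fin d) × EuclideanSpace ℝ (Fin d)) :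
    geodesicFlow (2 * Real.pi) z = z := by
  simp [geodesicFlow]

lemma IsFrame.geodesicFlow {z : EuclideanSpace ℝ (Fin d) × EuclideanSpace ℝ (Fin d)}
    (hz : IsFrame z) (θ : ℝ) : IsFrame (geodesicFlow θ z) := by
  obtain ⟨h1, h2, h3⟩ := hz
  have h1' : ⟪z.1, z.1⟫ = 1 := by rw [real_inner_self_eq_norm_sq, h1, one_pow]
  have h2' : ⟪z.2, z.2⟫ = 1 := by rw [real_inner_self_eq_norm_sq, h2, one_pow]
  have h3' : ⟪z.2, z.1⟫ = 0 := by rw [real_inner_comm, h3]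
  have hsq := Real.cos_sq_add_sin_sq θ
  refine ⟨?_, ?_, ?_⟩
  · rw [norm_eq_sqrt_real_inner, Real.sqrt_eq_one]
    simp only [GeodesicSlice.geodesicFlow, inner_add_left, inner_add_right, inner_smul_left,
      inner_smul_right, h1', h2', h3, h3', conj_trivial]
    linarith
  · rw [norm_eq_sqrt_real_inner, Real.sqrt_eq_one]
    simp only [GeodesicSlice.geodesicFlow, inner_add_left, inner_add_right, inner_smul_left,
      inner_smul_right, h1', h2', h3, h3', conj_trivial]
    linarith
  · simp only [GeodesicSlice.geodesicFlow, inner_add_left, inner_add_right, inner_smul_left,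
      inner_smul_right, h1', h2', h3, h3', conj_trivial]
    ring

/-- The geodesic flow preserves the Liouville measure: it commutes with the orthogonal group, which
acts transitively on orthonormal pairs, so the transported measure is again the invariant one. -/
lemma measurePreserving_geodesicFlow (hd : 2 ≤ d) (θ : ℝ) :
    MeasurePreserving (geodesicFlow θ) (liouville d) (liouville d) := by
  have hT : Measurable (geodesicFlow (d := d) θ) := by
    unfold geodesicFlow
    fun_prop
  refine ⟨hT, ?_⟩
  obtain ⟨z₀, hz₀⟩ : ∃ z₀ : EuclideanSpace ℝ (Fin d) × EuclideanSpace ℝ (Fin d), IsFrame z₀ :=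
    ⟨(EuclideanSpace.single ⟨0, by omega⟩ 1, EuclideanSpace.single ⟨1, by omega⟩ 1),
      by simp, by simp, by simp [EuclideanSpace.inner_single_left]⟩
  have hcomm : ∀ (g : Orth d) (z : EuclideanSpace ℝ (Fin d) × EuclideanSpace ℝ (Fin d)),
      orthAct g (geodesicFlow θ z) = geodesicFlow θ (orthAct g z) := fun g z => by
    simp [orthAct, geodesicFlow]
  have hmul : ∀ (g h : Orth d) (z : EuclideanSpace ℝ (Fin d) × EuclideanSpace ℝ (Fin d)),
      orthAct (g * h) z = orthAct g (orthAct h z) := fun _ _ _ => rfl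
  have hmap : ∀ g : Orth d, ((liouville d).map (geodesicFlow θ)).map (orthAct g) =
      (liouville d).map (geodesicFlow θ) := fun g => by
    have hg : Measurable (orthAct g) := measurable_orthAct.comp measurable_prodMk_left
    rw [Measure.map_map hg hT, show orthAct g ∘ geodesicFlow θ = geodesicFlow θ ∘ orthAct g from
      funext (hcomm g), ← Measure.map_map hT hg, map_orthAct_liouville]
  have horb : ∀ᵐ z ∂(liouville d).map (geodesicFlow θ), ∃ h, orthAct h z₀ = z := by
    have hfr : ∀ᵐ z ∂(liouville d).map (geodesicFlow θ), IsFrame z := by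
      rw [ae_map_iff hT.aemeasurable measurableSet_isFrame]
      filter_upwards [ae_isFrame] with z hz using hz.geodesicFlow θ
    filter_upwards [hfr] with z hz using exists_orthAct_eq hd hz₀ hz
  have horb' : ∀ᵐ z ∂liouville d, ∃ h, orthAct h z₀ = z := by
    filter_upwards [ae_isFrame] with z hz using exists_orthAct_eq hd hz₀ hz
  -- the inverse of a left-invariant measure is right-invariant
  let l : Measure (Orth d) := (Measure.haar : Measure (Orth d)).inv
  have hl : l univ ≠ 0 := by
    simp [l, Measure.inv_apply, NeZero.ne]
  have : IsFiniteMeasure l := ⟨by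
    rw [Measure.inv_apply, inv_univ]; exact measure_lt_top _ _⟩
  ext B hB
  have e1 := measure_mul_eq_of_invariant (l := l) measurable_orthAct hmul hmap horb hB
  have e2 := measure_mul_eq_of_invariant (l := l) measurable_orthAct hmul map_orthAct_liouville
    horb' hB
  rw [Measure.map_apply hT .univ, preimage_univ, ← e2] at e1
  exact (ENNReal.mul_left_inj hl (measure_ne_top l univ)).1 e1

/-! ### The level set kernels -/

/-- Integral of the indicator of `B` against the law of the point at which the shrinkage procedure
along the orbit of the pair `z` stops, when the accepted points are those with `t < q`. -/
def jump (q : EuclideanSpace ℝ (Fin d) → ℝ) (B : Set (EuclideanSpace ℝ (Fin d))) (t : ℝ)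
    (z : EuclideanSpace ℝ (Fin d) × EuclideanSpace ℝ (Fin d)) : ℝ≥0∞ :=
  ∑' n, fullTurn (fun θ => {y | t < q y}ᶜ.indicator 1 (geodesicFlow θ z).1)
    (fun θ => ({y | t < q y} ∩ B).indicator 1 (geodesicFlow θ z).1) n

lemma measurable_geodesicFlow_fst {Y : Type*} [MeasurableSpace Y]
    {z : Y → EuclideanSpace ℝ (Fin d) × EuclideanSpace ℝ (Fin d)} (hz : Measurable z) :
    Measurable fun w : Y × ℝ => (geodesicFlow w.2 (z w.1)).1 := by
  have h1 : Measurable fun w : Y × ℝ => (z w.1).1 := by fun_prop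
  have h2 : Measurable fun w : Y × ℝ => (z w.1).2 := by fun_prop
  unfold geodesicFlow
  fun_prop

lemma measurable_jump {q : EuclideanSpace ℝ (Fin d) → ℝ} (hq : Measurable q)
    {B : Set (EuclideanSpace ℝ (Fin d))} (hB : MeasurableSet B) {Y : Type*} [MeasurableSpace Y]
    {t : Y → ℝ} (ht : Measurable t)
    {z : Y → EuclideanSpace ℝ (Fin d) × EuclideanSpace ℝ (Fin d)} (hz : Measurable z) :
    Measurable fun y => jump q B (t y) (z y) := by
  have hflow := measurable_geodesicFlow_fst hz
  have hS : MeasurableSet {w : Y × ℝ | t w.1 < q (geodesicFlow w.2 (z w.1)).1} :=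
    measurableSet_lt (ht.comp measurable_fst) (hq.comp hflow)
  refine Measurable.tsum fun n => measurable_fullTurn ?_ ?_ n
  · have h : Measurable ({w : Y × ℝ | t w.1 < q (geodesicFlow w.2 (z w.1)).1}ᶜ.indicator
      (1 : Y × ℝ → ℝ≥0∞)) := measurable_one.indicator hS.compl
    exact h
  · have h : Measurable (({w : Y × ℝ | t w.1 < q (geodesicFlow w.2 (z w.1)).1} ∩
      {w | (geodesicFlow w.2 (z w.1)).1 ∈ B}).indicator (1 : Y × ℝ → ℝ≥0∞)) :=
      measurable_one.indicator (hS.inter (hflow hB))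
    exact h

/-- Stationarity of the uniform distribution on a superlevel set, lifted to the Liouville
measure. -/
lemma lintegral_liouville_mul_jump (hd : 2 ≤ d) {q : EuclideanSpace ℝ (Fin d) → ℝ}
    (hq : Measurable q) {B : Set (EuclideanSpace ℝ (Fin d))} (hB : MeasurableSet B) (t : ℝ) :
    ∫⁻ z, {y | t < q y}.indicator 1 z.1 * jump q B t z ∂liouville d =
      ∫⁻ z, ({y | t < q y} ∩ B).indicator 1 z.1 * jump q univ t z ∂liouville d := by
  have hL : MeasurableSet {y | t < q y} := measurableSet_lt measurable_const hq
  have hr : Measurable fun z : EuclideanSpace ℝ (Fin d) × EuclideanSpace ℝ (Fin d) =>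
      {y | t < q y}ᶜ.indicator (1 : EuclideanSpace ℝ (Fin d) → ℝ≥0∞) z.1 :=
    (measurable_one.indicator hL.compl).comp measurable_fst
  have hind : ∀ {D : Set (EuclideanSpace ℝ (Fin d))}, MeasurableSet D →
      Measurable fun z : EuclideanSpace ℝ (Fin d) × EuclideanSpace ℝ (Fin d) =>
        D.indicator (1 : EuclideanSpace ℝ (Fin d) → ℝ≥0∞) z.1 := fun hD =>
    (measurable_one.indicator hD).comp measurable_fst
  have hterm : ∀ {D : Set (EuclideanSpace ℝ (Fin d))}, MeasurableSet D → ∀ n,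
      Measurable fun z : EuclideanSpace ℝ (Fin d) × EuclideanSpace ℝ (Fin d) =>
        fullTurn (fun θ => {y | t < q y}ᶜ.indicator 1 (geodesicFlow θ z).1)
          (fun θ => D.indicator 1 (geodesicFlow θ z).1) n := fun {D} hD n => by
    have hflow := measurable_geodesicFlow_fst (d := d) measurable_id
    exact measurable_fullTurn
      (r := fun z θ => {y | t < q y}ᶜ.indicator 1 (geodesicFlow θ z).1)
      (g := fun z θ => D.indicator 1 (geodesicFlow θ z).1)
      ((measurable_one.indicator hL.compl).comp hflow)
      ((measurable_one.indicator hD).comp hflow) n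
  have hprod : ∀ {D D' : Set (EuclideanSpace ℝ (Fin d))}, MeasurableSet D → MeasurableSet D' →
      ∀ n, AEMeasurable (fun z : EuclideanSpace ℝ (Fin d) × EuclideanSpace ℝ (Fin d) =>
        D.indicator 1 z.1 * fullTurn (fun θ => {y | t < q y}ᶜ.indicator 1 (geodesicFlow θ z).1)
          (fun θ => D'.indicator 1 (geodesicFlow θ z).1) n) (liouville d) := fun hD hD' n =>
    ((hind hD).mul (hterm hD' n)).aemeasurable
  unfold jump
  simp_rw [← ENNReal.tsum_mul_left]
  rw [lintegral_tsum (hprod hL (hL.inter hB)), lintegral_tsum (hprod (hL.inter hB) (hL.inter .univ))]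
  refine tsum_congr fun n => ?_
  rw [inter_univ]
  exact lintegral_mul_fullTurn_comm measurable_geodesicFlow geodesicFlow_add geodesicFlow_two_pi
    (measurePreserving_geodesicFlow hd) hr (hind hL) (hind (hL.inter hB)) n

/-- Extension of a function on the sphere to the ambient space by zero. -/
def ambient (p : Sph d → ℝ) : EuclideanSpace ℝ (Fin d) → ℝ := Function.extend Subtype.val p 0

lemma ambient_coe (p : Sph d → ℝ) (x : Sph d) : ambient p x = p x :=
  Subtype.val_injective.extend_apply p 0 x

lemma measurableEmbedding_coe_sph :
    MeasurableEmbedding ((↑) : Sph d → EuclideanSpace ℝ (Fin d)) :=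
  MeasurableEmbedding.subtype_coe Metric.isClosed_sphere.measurableSet

lemma measurable_ambient {p : Sph d → ℝ} (hp : Measurable p) : Measurable (ambient p) :=
  measurableEmbedding_coe_sph.measurable_extend hp measurable_zero

lemma indicator_superlevel (p : Sph d → ℝ) (t : ℝ) (x : Sph d) :
    {y | t < ambient p y}.indicator (1 : EuclideanSpace ℝ (Fin d) → ℝ≥0∞) x =
      {x | t < p x}.indicator 1 x := by
  simp only [indicator, mem_ofPred_eq, ambient_coe, Pi.one_apply]

lemma indicator_superlevel_inter (p : Sph d → ℝ) (t : ℝ) (A : Set (Sph d)) (x : Sph d) :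
    ({y | t < ambient p y} ∩ (↑) '' A).indicator (1 : EuclideanSpace ℝ (Fin d) → ℝ≥0∞) x =
      ({x | t < p x} ∩ A).indicator 1 x := by
  have hmem : (x : EuclideanSpace ℝ (Fin d)) ∈ ((↑) '' A : Set (EuclideanSpace ℝ (Fin d))) ↔
      x ∈ A := Subtype.val_injective.mem_set_image
  have hiff : (x : EuclideanSpace ℝ (Fin d)) ∈ {y | t < ambient p y} ∩ (↑) '' A ↔
      x ∈ {x | t < p x} ∩ A :=
    and_congr (by rw [mem_ofPred_eq, mem_ofPred_eq, ambient_coe]) hmem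
  by_cases h : x ∈ {x | t < p x} ∩ A
  · rw [indicator_of_mem h, indicator_of_mem (hiff.2 h)]; rfl
  · rw [indicator_of_notMem h, indicator_of_notMem (fun h' => h (hiff.1 h'))]

lemma geodesicFlow_coe (x : Sph d) (v : UnitTangent x) (θ : ℝ) :
    (geodesicFlow θ ((x : EuclideanSpace ℝ (Fin d)),
      ((v : Tangent x) : EuclideanSpace ℝ (Fin d)))).1 = geodesic x v θ := rfl

lemma continuous_geodesic (x : Sph d) (v : UnitTangent x) : Continuous (geodesic x v) := by
  refine Continuous.subtype_mk ?_ _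
  fun_prop

lemma periodic_geodesic (x : Sph d) (v : UnitTangent x) :
    Function.Periodic (geodesic x v) (2 * Real.pi) := fun θ => by
  refine Subtype.ext ?_
  simp [coe_geodesic]

lemma geodesic_zero (x : Sph d) (v : UnitTangent x) : geodesic x v 0 = x := by
  refine Subtype.ext ?_
  simp [coe_geodesic]

lemma setLIntegral_shrinkDist {p : Sph d → ℝ} (hp : Measurable p) (x : Sph d)
    (v : UnitTangent x) (t : ℝ) {A : Set (Sph d)} (hA : MeasurableSet A) :
    ∫⁻ θ in Ico 0 (2 * Real.pi), A.indicator 1 (geodesic x v θ) ∂shrinkDist p x v t =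
      jump (ambient p) ((↑) '' A) t (↑x, ((v : Tangent x) : _)) := by
  have hγ := (continuous_geodesic x v).measurable
  have hS : MeasurableSet {θ | t < p (geodesic x v θ)} :=
    measurableSet_lt measurable_const (hp.comp hγ)
  rw [shrinkDist, lintegral_shrinkLaw hS (h := fun θ => A.indicator 1 (geodesic x v θ))
    ((measurable_one.indicator hA).comp hγ)
    (fun θ => by simp only [periodic_geodesic x v θ]), jump]
  refine tsum_congr fun n => ?_
  congr 1
  · funext θ
    simp only [geodesicFlow_coe, indicator, mem_compl_iff, mem_ofPred_eq, ambient_coe, Pi.one_apply]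
  · funext θ
    rw [geodesicFlow_coe, indicator_superlevel_inter]
    by_cases h1 : t < p (geodesic x v θ) <;> by_cases h2 : geodesic x v θ ∈ A <;>
      simp [indicator, h1, h2]

lemma levelKernel_eq {p : Sph d → ℝ} (hp : Measurable p) (t : ℝ) (x : Sph d) {A : Set (Sph d)}
    (hA : MeasurableSet A) :
    levelKernel p t x A = (ENNReal.ofReal (area (d - 1)))⁻¹ *
      ∫⁻ v, jump (ambient p) ((↑) '' A) t (↑x, ((v : Tangent x) : _)) ∂tangentSigma x := by
  rw [levelKernel]
  simp only [setLIntegral_shrinkDist hp x _ t hA]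

lemma measurable_levelKernel {p : Sph d → ℝ} (hp : Measurable p) {A : Set (Sph d)}
    (hA : MeasurableSet A) : Measurable fun w : Sph d × ℝ => levelKernel p w.2 w.1 A := by
  simp only [levelKernel_eq hp _ _ hA]
  have hjump : Measurable fun q : (Sph d × ℝ) × EuclideanSpace ℝ (Fin d) =>
      jump (ambient p) ((↑) '' A) q.1.2 ((q.1.1 : EuclideanSpace ℝ (Fin d)), q.2) :=
    measurable_jump (measurable_ambient hp)
      (measurableEmbedding_coe_sph.measurableSet_image' hA) (by fun_prop) (by fun_prop)
  have h := measurable_lintegral_tangentSigma (a := fun w : Sph d × ℝ => w.1)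
    (F := fun w v => jump (ambient p) (Subtype.val '' A) w.2 ((w.1 : EuclideanSpace ℝ (Fin d)), v))
    measurable_fst hjump
  exact h.const_mul _

lemma measurable_levelKernel_right {p : Sph d → ℝ} (hp : Measurable p) (x : Sph d)
    {A : Set (Sph d)} (hA : MeasurableSet A) : Measurable fun t => levelKernel p t x A :=
  (measurable_levelKernel hp hA).comp (f := fun t : ℝ => (x, t)) (by fun_prop)

lemma ofReal_area (k : ℕ) : ENNReal.ofReal (area k) = sigma k univ := by
  rw [area, ofReal_measureReal]

lemma sigma_univ_ne_zero {k : ℕ} (hk : 1 ≤ k) : sigma k univ ≠ 0 := by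
  have : Nonempty (Fin k) := ⟨⟨0, hk⟩⟩
  have : Nontrivial (EuclideanSpace ℝ (Fin k)) := inferInstance
  rw [Measure.measure_univ_ne_zero]
  exact Measure.toSphere_ne_zero _

/-- Almost sure termination along each geodesic through a point of the open level set. -/
lemma jump_univ {p : Sph d → ℝ} (hlsc : LowerSemicontinuous p) (x : Sph d) (v : UnitTangent x)
    {t : ℝ} (ht : t < p x) :
    jump (ambient p) univ t (↑x, ((v : Tangent x) : _)) = 1 := by
  have hγ := continuous_geodesic x v
  have hopen : IsOpen {θ | t < p (geodesic x v θ)} :=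
    (hlsc.isOpen_preimage t).preimage hγ
  have h0 : (0 : ℝ) ∈ {θ | t < p (geodesic x v θ)} := by
    rw [mem_ofPred_eq, geodesic_zero]; exact ht
  obtain ⟨ε, hε, hball⟩ := Metric.isOpen_iff.1 hopen 0 h0
  have hmeas := hopen.measurableSet
  simp only [jump, geodesicFlow_coe, inter_univ]
  have hacc : ∀ θ, {y | t < ambient p y}.indicator (1 : EuclideanSpace ℝ (Fin d) → ℝ≥0∞)
      (geodesic x v θ : EuclideanSpace ℝ (Fin d)) =
      {θ | t < p (geodesic x v θ)}.indicator 1 θ := fun θ => indicator_superlevel p t _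
  have hrej : ∀ θ, {y | t < ambient p y}ᶜ.indicator (1 : EuclideanSpace ℝ (Fin d) → ℝ≥0∞)
      (geodesic x v θ : EuclideanSpace ℝ (Fin d)) =
      {θ | t < p (geodesic x v θ)}ᶜ.indicator 1 θ := fun θ => by
    simp only [indicator, mem_compl_iff, mem_ofPred_eq, ambient_coe, Pi.one_apply]
  simp only [hacc, hrej]
  refine tsum_fullTurn (ε := ε) (measurable_one.indicator hmeas.compl)
    (measurable_one.indicator hmeas) (fun θ => ?_) (fun θ => ?_) hε (fun θ hθ => ?_)
  · exact congrFun (indicator_self_add_compl _ (1 : ℝ → ℝ≥0∞)) θ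
  · simp only [indicator, mem_compl_iff, mem_ofPred_eq, periodic_geodesic x v θ, Pi.one_apply]
  · refine indicator_of_notMem (notMem_compl_iff.2 (hball ?_)) _
    rwa [Real.ball_eq_Ioo, zero_sub, zero_add]

lemma levelKernel_univ (hd : 2 ≤ d) {p : Sph d → ℝ} (hlsc : LowerSemicontinuous p) (x : Sph d)
    {t : ℝ} (ht : t < p x) : levelKernel p t x univ = 1 := by
  have h1 : ∀ v, ∫⁻ θ in Ico 0 (2 * Real.pi), (univ : Set (Sph d)).indicator 1 (geodesic x v θ)
      ∂shrinkDist p x v t = 1 := fun v => by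
    rw [setLIntegral_shrinkDist hlsc.measurable x v t .univ, ← jump_univ hlsc x v ht]
    simp only [jump, geodesicFlow_coe, indicator_superlevel_inter, inter_univ,
      indicator_superlevel]
  rw [levelKernel]
  simp only [h1, lintegral_one, tangentSigma_univ, ofReal_area]
  exact ENNReal.inv_mul_cancel (sigma_univ_ne_zero (by omega)) (measure_ne_top _ _)

/-- The level set kernel leaves the surface measure restricted to the superlevel set invariant. -/
lemma lintegral_indicator_mul_levelKernel (hd : 2 ≤ d) {p : Sph d → ℝ}
    (hlsc : LowerSemicontinuous p) (t : ℝ) {A : Set (Sph d)} (hA : MeasurableSet A) :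
    ∫⁻ x, {x | t < p x}.indicator 1 x * levelKernel p t x A ∂sigma d =
      sigma d ({x | t < p x} ∩ A) := by
  have hp := hlsc.measurable
  have hq := measurable_ambient hp
  have hA' := measurableEmbedding_coe_sph.measurableSet_image' hA
  have hL : MeasurableSet {x | t < p x} := measurableSet_lt measurable_const hp
  have hL' : MeasurableSet {y | t < ambient p y} := measurableSet_lt measurable_const hq
  have hω : (sigma (d - 1) univ)⁻¹ ≠ ∞ := ENNReal.inv_ne_top.2 (sigma_univ_ne_zero (by omega))
  have key := lintegral_liouville_mul_jump hd hq hA' t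
  rw [lintegral_liouville, lintegral_liouville] at key
  rotate_left
  · exact ((measurable_one.indicator (hL'.inter hA')).comp measurable_fst).mul
      (measurable_jump hq .univ measurable_const measurable_id)
  · exact ((measurable_one.indicator hL').comp measurable_fst).mul
      (measurable_jump hq hA' measurable_const measurable_id)
  have hleft : ∀ x : Sph d, {x | t < p x}.indicator 1 x * levelKernel p t x A =
      (sigma (d - 1) univ)⁻¹ * ∫⁻ v, {y | t < ambient p y}.indicator (1 : EuclideanSpace ℝ (Fin d) → ℝ≥0∞)
        (x : EuclideanSpace ℝ (Fin d)) * jump (ambient p) ((↑) '' A) t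
          (↑x, ((v : Tangent x) : _)) ∂tangentSigma x := fun x => by
    rw [levelKernel_eq hp t x hA, ofReal_area, lintegral_const_mul', indicator_superlevel]
    · ring
    · rw [indicator_superlevel]; by_cases h : x ∈ {x | t < p x} <;> simp [h]
  have hright : ∀ x : Sph d, ∫⁻ v, ({y | t < ambient p y} ∩ (↑) '' A).indicator (1 : EuclideanSpace ℝ (Fin d) → ℝ≥0∞)
      (x : EuclideanSpace ℝ (Fin d)) * jump (ambient p) univ t
        (↑x, ((v : Tangent x) : _)) ∂tangentSigma x =
      sigma (d - 1) univ * ({x | t < p x} ∩ A).indicator 1 x := fun x => by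
    rw [indicator_superlevel_inter]
    by_cases h : x ∈ {x | t < p x} ∩ A
    · simp only [jump_univ hlsc x _ h.1, indicator_of_mem h, Pi.one_apply, mul_one, lintegral_one,
        tangentSigma_univ]
    · simp only [indicator_of_notMem h, zero_mul, mul_zero, lintegral_zero]
  simp only [hleft]
  rw [lintegral_const_mul' _ _ hω, key]
  simp only [hright]
  rw [lintegral_const_mul' _ _ (measure_ne_top _ _), lintegral_indicator_one (hL.inter hA),
    ← mul_assoc, ENNReal.inv_mul_cancel (sigma_univ_ne_zero (by omega)) (measure_ne_top _ _),
    one_mul]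

/-! ### The transition kernel -/

lemma levelKernel_iUnion {p : Sph d → ℝ} (hp : Measurable p) (t : ℝ) (x : Sph d)
    {A : ℕ → Set (Sph d)} (hA : ∀ i, MeasurableSet (A i))
    (hdisj : Pairwise (Function.onFun Disjoint A)) :
    levelKernel p t x (⋃ i, A i) = ∑' i, levelKernel p t x (A i) := by
  have hγ := fun v => (continuous_geodesic x v).measurable
  have hinner : ∀ v, ∫⁻ θ in Ico 0 (2 * Real.pi), (⋃ i, A i).indicator 1 (geodesic x v θ)
      ∂shrinkDist p x v t = ∑' i, ∫⁻ θ in Ico 0 (2 * Real.pi), (A i).indicator 1 (geodesic x v θ)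
      ∂shrinkDist p x v t := fun v => by
    have hmap : ∀ {B : Set (Sph d)}, MeasurableSet B →
        ∫⁻ θ in Ico 0 (2 * Real.pi), B.indicator 1 (geodesic x v θ) ∂shrinkDist p x v t =
          ((shrinkDist p x v t).restrict (Ico 0 (2 * Real.pi))).map (geodesic x v) B := by
      intro B hB
      rw [← lintegral_indicator_one hB, lintegral_map (measurable_one.indicator hB) (hγ v)]
    rw [hmap (MeasurableSet.iUnion hA), measure_iUnion hdisj hA]
    exact tsum_congr fun i => (hmap (hA i)).symm
  have hmeas : ∀ i, Measurable fun v => ∫⁻ θ in Ico 0 (2 * Real.pi),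
      (A i).indicator 1 (geodesic x v θ) ∂shrinkDist p x v t := fun i => by
    simp only [setLIntegral_shrinkDist hp x _ t (hA i)]
    exact measurable_jump (measurable_ambient hp)
      (measurableEmbedding_coe_sph.measurableSet_image' (hA i)) measurable_const (by fun_prop)
  simp only [levelKernel, hinner]
  rw [lintegral_tsum fun i => (hmeas i).aemeasurable, ENNReal.tsum_mul_left]

lemma levelKernel_empty (p : Sph d → ℝ) (t : ℝ) (x : Sph d) : levelKernel p t x ∅ = 0 := by
  simp [levelKernel]

lemma measurable_sssTransition {p : Sph d → ℝ} (hp : Measurable p) {A : Set (Sph d)}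
    (hA : MeasurableSet A) : Measurable fun x => sssTransition p x A := by
  unfold sssTransition
  refine Measurable.mul (by fun_prop) ?_
  simp only [← lintegral_indicator measurableSet_Ioo]
  have hS : MeasurableSet {w : Sph d × ℝ | w.2 ∈ Ioo 0 (p w.1)} :=
    (measurableSet_lt measurable_const measurable_snd).inter
      (measurableSet_lt measurable_snd (hp.comp measurable_fst))
  exact ((measurable_levelKernel hp hA).indicator hS).lintegral_prod_right'

lemma sssTransition_iUnion {p : Sph d → ℝ} (hp : Measurable p) (x : Sph d)
    {A : ℕ → Set (Sph d)} (hA : ∀ i, MeasurableSet (A i))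
    (hdisj : Pairwise (Function.onFun Disjoint A)) :
    sssTransition p x (⋃ i, A i) = ∑' i, sssTransition p x (A i) := by
  simp only [sssTransition, levelKernel_iUnion hp _ x hA hdisj]
  rw [lintegral_tsum fun i => (measurable_levelKernel_right hp x (hA i)).aemeasurable,
    ENNReal.tsum_mul_left]

/-- The transition kernel of the geodesic shrinkage slice sampler. -/
def sssKernel (p : Sph d → ℝ) (hp : Measurable p) : Kernel (Sph d) (Sph d) where
  toFun x := Measure.ofMeasurable (fun A _ => sssTransition p x A)
    (by simp [sssTransition, levelKernel_empty]) fun _ hA hdisj => sssTransition_iUnion hp x hA hdisj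
  measurable' := Measure.measurable_of_measurable_coe _ fun A hA => by
    simp only [Measure.ofMeasurable_apply A hA]
    exact measurable_sssTransition hp hA

lemma sssKernel_apply {p : Sph d → ℝ} (hp : Measurable p) (x : Sph d) {A : Set (Sph d)}
    (hA : MeasurableSet A) : sssKernel p hp x A = sssTransition p x A :=
  Measure.ofMeasurable_apply (mU := fun _ hB hdisj => sssTransition_iUnion hp x hB hdisj) A hA

lemma isMarkovKernel_sssKernel (hd : 2 ≤ d) {p : Sph d → ℝ} (hlsc : LowerSemicontinuous p)
    (hpos : ∀ x, 0 < p x) : IsMarkovKernel (sssKernel p hlsc.measurable) := by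
  refine ⟨fun x => ⟨?_⟩⟩
  rw [sssKernel_apply _ x .univ, sssTransition, setLIntegral_congr_fun measurableSet_Ioo
    fun t ht => levelKernel_univ hd hlsc x ht.2, setLIntegral_one, Real.volume_Ioo, sub_zero]
  exact ENNReal.inv_mul_cancel (by simpa using hpos x) ENNReal.ofReal_ne_top

/-! ### Invariance of the target -/

/-- Invariance of the unnormalised target, by integration of the invariance of the level set kernels
over the levels. -/
lemma lintegral_ofReal_mul_sssTransition (hd : 2 ≤ d) {p : Sph d → ℝ}
    (hlsc : LowerSemicontinuous p) (hpos : ∀ x, 0 < p x) {A : Set (Sph d)}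
    (hA : MeasurableSet A) :
    ∫⁻ x, ENNReal.ofReal (p x) * sssTransition p x A ∂sigma d =
      ∫⁻ x in A, ENNReal.ofReal (p x) ∂sigma d := by
  have hp := hlsc.measurable
  have hS : MeasurableSet {w : Sph d × ℝ | w.2 < p w.1} :=
    measurableSet_lt measurable_snd (hp.comp measurable_fst)
  have hL : ∀ t, MeasurableSet {x | t < p x} := fun t => measurableSet_lt measurable_const hp
  have hind : Measurable fun w : Sph d × ℝ => {x | w.2 < p x}.indicator (1 : Sph d → ℝ≥0∞) w.1 := by
    have h : Measurable ({w : Sph d × ℝ | w.2 < p w.1}.indicator (1 : Sph d × ℝ → ℝ≥0∞)) :=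
      measurable_one.indicator hS
    exact h
  -- both sides are integrated over the region below the graph of `p`
  have hgraph : ∀ (x : Sph d) {f : ℝ → ℝ≥0∞}, Measurable f → ∫⁻ t in Ioo 0 (p x), f t =
      ∫⁻ t in Ioi (0 : ℝ), {x | t < p x}.indicator 1 x * f t := fun x f hf => by
    rw [← lintegral_indicator measurableSet_Ioo, ← lintegral_indicator measurableSet_Ioi]
    refine lintegral_congr fun t => ?_
    by_cases h0 : 0 < t <;> by_cases h1 : t < p x <;> simp [indicator, h0, h1]
  calc ∫⁻ x, ENNReal.ofReal (p x) * sssTransition p x A ∂sigma d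
      = ∫⁻ x, ∫⁻ t in Ioi (0 : ℝ), {x | t < p x}.indicator 1 x * levelKernel p t x A
          ∂volume ∂sigma d := by
        refine lintegral_congr fun x => ?_
        rw [sssTransition, ← mul_assoc, ENNReal.mul_inv_cancel (by simpa using hpos x)
          ENNReal.ofReal_ne_top, one_mul, hgraph x (measurable_levelKernel_right hp x hA)]
    _ = ∫⁻ t in Ioi (0 : ℝ), sigma d ({x | t < p x} ∩ A) := by
        rw [lintegral_lintegral_swap]
        · simp only [lintegral_indicator_mul_levelKernel hd hlsc _ hA]
        · exact (hind.mul (measurable_levelKernel hp hA)).aemeasurable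
    _ = ∫⁻ t in Ioi (0 : ℝ), ∫⁻ x in A, {x | t < p x}.indicator 1 x ∂sigma d := by
        refine lintegral_congr fun t => ?_
        rw [lintegral_indicator_one (hL t), Measure.restrict_apply (hL t)]
    _ = ∫⁻ x in A, ∫⁻ t in Ioi (0 : ℝ), {x | t < p x}.indicator 1 x ∂volume ∂sigma d :=
        lintegral_lintegral_swap (hind.comp measurable_swap).aemeasurable
    _ = _ := by
        refine lintegral_congr fun x => ?_
        have h := hgraph x (f := fun _ => 1) measurable_const
        simp only [mul_one, setLIntegral_one, Real.volume_Ioo, sub_zero] at h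
        exact h.symm

lemma mass_ne_zero (hd : 1 ≤ d) {p : Sph d → ℝ} (hp : Measurable p) (hpos : ∀ x, 0 < p x) :
    mass p ≠ 0 := by
  have hsupp : Function.support (fun x => ENNReal.ofReal (p x)) = univ :=
    eq_univ_of_forall fun x => (ENNReal.ofReal_pos.2 (hpos x)).ne'
  rw [mass, ← pos_iff_ne_zero, lintegral_pos_iff_support (by fun_prop), hsupp, pos_iff_ne_zero]
  exact sigma_univ_ne_zero hd

lemma mass_ne_top {p : Sph d → ℝ} (hbdd : BddAbove (range p)) : mass p ≠ ∞ := by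
  obtain ⟨M, hM⟩ := hbdd
  refine ne_top_of_le_ne_top ?_ (lintegral_mono (g := fun _ => ENNReal.ofReal M) fun x =>
    ENNReal.ofReal_le_ofReal (hM (mem_range_self x)))
  rw [lintegral_const]
  exact ENNReal.mul_ne_top ENNReal.ofReal_ne_top (measure_ne_top _ _)

lemma isProbabilityMeasure_target (hd : 1 ≤ d) {p : Sph d → ℝ} (hp : Measurable p)
    (hpos : ∀ x, 0 < p x) (hbdd : BddAbove (range p)) : IsProbabilityMeasure (target p) := by
  refine ⟨?_⟩
  rw [target, Measure.smul_apply, withDensity_apply _ .univ, setLIntegral_univ, smul_eq_mul]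
  exact ENNReal.inv_mul_cancel (mass_ne_zero hd hp hpos) (mass_ne_top hbdd)

lemma target_bind_sssKernel (hd : 2 ≤ d) {p : Sph d → ℝ} (hlsc : LowerSemicontinuous p)
    (hpos : ∀ x, 0 < p x) : (target p).bind (sssKernel p hlsc.measurable) = target p := by
  have hp := hlsc.measurable
  ext A hA
  rw [Measure.bind_apply hA (sssKernel p hp).aemeasurable, target, lintegral_smul_measure,
    lintegral_withDensity_eq_lintegral_mul _ (by fun_prop) ((sssKernel p hp).measurable_coe hA),
    Measure.smul_apply, withDensity_apply _ hA, ← lintegral_ofReal_mul_sssTransition hd hlsc hpos hA]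
  simp only [Pi.mul_apply, sssKernel_apply hp _ hA]

/-! ### The minorization -/

/-- Only the first candidate is kept, and only levels low enough to accept all of `C`. -/
lemma le_levelKernel (hd : 2 ≤ d) {p : Sph d → ℝ} (hp : Measurable p) (x : Sph d)
    {A C : Set (Sph d)} (hA : MeasurableSet A) (hC : MeasurableSet C) {t : ℝ}
    (ht : ∀ y ∈ C, t < p y) :
    (sigma (d - 1) univ)⁻¹ * ((ENNReal.ofReal (2 * Real.pi))⁻¹ * sigma d (A ∩ C)) ≤
      levelKernel p t x A := by
  have hAC := measurableEmbedding_coe_sph.measurableSet_image' (hA.inter hC)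
  have hle : sigma d (A ∩ C) ≤ ∫⁻ v, ∫⁻ θ in Ioo 0 Real.pi,
      (A ∩ C).indicator 1 (geodesic x v θ) ∂volume ∂tangentSigma x := by
    have h := lintegral_sigma_le x hd (f := ((↑) '' (A ∩ C)).indicator 1)
      (measurable_one.indicator hAC)
    have hind : ∀ y : Sph d, (Subtype.val '' (A ∩ C)).indicator
        (1 : EuclideanSpace ℝ (Fin d) → ℝ≥0∞) y = (A ∩ C).indicator 1 y := fun y =>
      indicator_image Subtype.val_injective
    simp only [hind] at h
    rwa [lintegral_indicator_one (hA.inter hC)] at h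
  rw [levelKernel_eq hp t x hA, ofReal_area]
  refine mul_le_mul_right ((mul_le_mul_right hle _).trans ?_) _
  rw [← lintegral_const_mul' _ _ (by simp [Real.pi_pos])]
  refine lintegral_mono fun v => ?_
  refine le_trans ?_ (ENNReal.le_tsum 0)
  rw [fullTurn, lintegral_unif, sub_zero]
  refine mul_le_mul_right ?_ _
  refine (lintegral_mono_set (Ioo_subset_Ioo_right (by linarith [Real.pi_pos]))).trans
    (lintegral_mono fun θ => ?_)
  rw [geodesicFlow_coe, indicator_superlevel_inter]
  have hsub : A ∩ C ⊆ {y | t < p y} ∩ A := fun y hy => ⟨ht y hy.2, hy.1⟩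
  exact indicator_le_indicator_of_subset hsub (fun _ => zero_le) _

lemma le_sssKernel (hd : 2 ≤ d) {p : Sph d → ℝ} (hp : Measurable p) (hpos : ∀ x, 0 < p x)
    {C : Set (Sph d)} (hC : MeasurableSet C) {β : ℝ} (hβ0 : 0 < β) (hβ1 : β ≤ 1)
    (hβ : ∀ x, ∀ y ∈ C, β * p x ≤ p y) (x : Sph d) :
    (ENNReal.ofReal β * ((sigma (d - 1) univ)⁻¹ * (ENNReal.ofReal (2 * Real.pi))⁻¹)) •
      (sigma d).restrict C ≤ sssKernel p hp x := by
  refine Measure.le_iff.2 fun A hA => ?_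
  rw [sssKernel_apply hp x hA, Measure.smul_apply, Measure.restrict_apply hA, smul_eq_mul,
    sssTransition]
  have hsub : Ioo 0 (β * p x) ⊆ Ioo 0 (p x) :=
    Ioo_subset_Ioo_right (mul_le_of_le_one_left (hpos x).le hβ1)
  calc _ = (ENNReal.ofReal (p x))⁻¹ * ∫⁻ _ in Ioo 0 (β * p x),
        (sigma (d - 1) univ)⁻¹ * ((ENNReal.ofReal (2 * Real.pi))⁻¹ * sigma d (A ∩ C)) := by
        rw [setLIntegral_const, Real.volume_Ioo, sub_zero, ENNReal.ofReal_mul hβ0.le]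
        have h1 : (ENNReal.ofReal (p x))⁻¹ * ENNReal.ofReal (p x) = 1 :=
          ENNReal.inv_mul_cancel (by simpa using hpos x) ENNReal.ofReal_ne_top
        calc _ = ((ENNReal.ofReal (p x))⁻¹ * ENNReal.ofReal (p x)) * (ENNReal.ofReal β *
              ((sigma (d - 1) univ)⁻¹ * (ENNReal.ofReal (2 * Real.pi))⁻¹) * sigma d (A ∩ C)) := by
              rw [h1, one_mul]
          _ = _ := by ring
    _ ≤ (ENNReal.ofReal (p x))⁻¹ * ∫⁻ t in Ioo 0 (β * p x), levelKernel p t x A := by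
        refine mul_le_mul_right (setLIntegral_mono' measurableSet_Ioo fun t ht => ?_) _
        exact le_levelKernel hd hp x hA hC fun y hy => ht.2.trans_le (hβ x y hy)
    _ ≤ _ := mul_le_mul_right (lintegral_mono_set hsub) _

lemma sigma_univ_le (hd : 2 ≤ d) :
    (sigma d).real univ ≤ Real.pi * area (d - 1) := by
  obtain ⟨x⟩ : Nonempty (Sph d) := by
    by_contra h
    rw [not_nonempty_iff] at h
    exact sigma_univ_ne_zero (k := d) (by omega) (by simp [Measure.eq_zero_of_isEmpty])
  have h := lintegral_sigma_le x hd (f := fun _ => 1) measurable_const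
  simp only [lintegral_one, Measure.restrict_apply_univ, Real.volume_Ioo, sub_zero,
    lintegral_const, tangentSigma_univ] at h
  rw [area, Measure.real, Measure.real, ← ENNReal.toReal_ofReal Real.pi_pos.le,
    ← ENNReal.toReal_mul]
  exact ENNReal.toReal_mono (by finiteness) h

end GeodesicSlice

end

theorem mainTheorem2 (d : ℕ) (hd : 3 ≤ d) (p : GeodesicSlice.Sph d → ℝ)
    (hp_pos : ∀ x, 0 < p x) (hp_lsc : LowerSemicontinuous p)
    (C : Set (GeodesicSlice.Sph d)) (hC : MeasurableSet C)
    (hC_pos : 0 < GeodesicSlice.sigma d C)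
    (hp_inf : 0 < ⨅ y : C, p y) (hp_sup : BddAbove (Set.range p))
    (β ρ : ℝ) (hβ : β = (⨅ y : C, p y) / ⨆ y, p y)
    (hρ : ρ = 1 - β / (2 * Real.pi) *
      ((GeodesicSlice.sigma d).real C / GeodesicSlice.area (d - 1))) :
    (0 < β ∧ β ≤ 1) ∧ (0 < ρ ∧ ρ < 1) ∧
      ∃ H : ProbabilityTheory.Kernel (GeodesicSlice.Sph d) (GeodesicSlice.Sph d),
        ProbabilityTheory.IsMarkovKernel H ∧
        (∀ x A, MeasurableSet A → H x A = GeodesicSlice.sssTransition p x A) ∧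
        ∀ n : ℕ, ⨆ x, GeodesicSlice.dTV ((H ^ n) x) (GeodesicSlice.target p) ≤
          ENNReal.ofReal (ρ ^ n) := by
  have hd2 : 2 ≤ d := by omega
  have hp := hp_lsc.measurable
  obtain ⟨y₀, hy₀⟩ : C.Nonempty := by
    rw [nonempty_iff_ne_empty]
    rintro rfl
    simp at hC_pos
  have hbelow : BddBelow (range fun y : C => p y) := ⟨0, by
    rintro _ ⟨y, rfl⟩; exact (hp_pos y).le⟩
  have hinf : ∀ y ∈ C, ⨅ y : C, p y ≤ p y := fun y hy => ciInf_le hbelow (⟨y, hy⟩ : C)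
  have hsup : ∀ x, p x ≤ ⨆ y, p y := fun x => le_ciSup hp_sup x
  have hs : 0 < ⨆ y, p y := (hp_pos y₀).trans_le (hsup y₀)
  have hβ0 : 0 < β := hβ ▸ div_pos hp_inf hs
  have hβ1 : β ≤ 1 := by
    rw [hβ, div_le_one hs]
    exact (hinf y₀ hy₀).trans (hsup y₀)
  have hβC : ∀ x, ∀ y ∈ C, β * p x ≤ p y := fun x y hy => by
    calc β * p x ≤ β * ⨆ y, p y := mul_le_mul_of_nonneg_left (hsup x) hβ0.le
      _ = ⨅ y : C, p y := by rw [hβ, div_mul_cancel₀ _ hs.ne']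
      _ ≤ p y := hinf y hy
  have harea : 0 < GeodesicSlice.area (d - 1) :=
    ENNReal.toReal_pos (GeodesicSlice.sigma_univ_ne_zero (by omega)) (measure_ne_top _ _)
  have hσC : 0 < (GeodesicSlice.sigma d).real C :=
    ENNReal.toReal_pos hC_pos.ne' (measure_ne_top _ _)
  set ε := β / (2 * Real.pi) * ((GeodesicSlice.sigma d).real C / GeodesicSlice.area (d - 1))
    with hε
  have hε0 : 0 < ε := mul_pos (div_pos hβ0 Real.two_pi_pos) (div_pos hσC harea)
  have hε1 : ε < 1 := by
    have h1 : (GeodesicSlice.sigma d).real C / GeodesicSlice.area (d - 1) ≤ Real.pi :=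
      (div_le_iff₀ harea).2 ((measureReal_mono (subset_univ C)).trans
        (GeodesicSlice.sigma_univ_le hd2))
    have h2 : β / (2 * Real.pi) ≤ 1 / (2 * Real.pi) := by gcongr
    calc ε ≤ 1 / (2 * Real.pi) * Real.pi := by
          rw [hε]; gcongr
      _ = 1 / 2 := by field_simp
      _ < 1 := by norm_num
  refine ⟨⟨hβ0, hβ1⟩, ⟨by linarith, by linarith⟩, GeodesicSlice.sssKernel p hp,
    GeodesicSlice.isMarkovKernel_sssKernel hd2 hp_lsc hp_pos,
    fun x A hA => GeodesicSlice.sssKernel_apply hp x hA, fun n => iSup_le fun x => ?_⟩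
  have := GeodesicSlice.isMarkovKernel_sssKernel hd2 hp_lsc hp_pos
  have := GeodesicSlice.isProbabilityMeasure_target (d := d) (by omega) hp hp_pos hp_sup
  set η : Measure (GeodesicSlice.Sph d) := (ENNReal.ofReal β *
    ((GeodesicSlice.sigma (d - 1) univ)⁻¹ * (ENNReal.ofReal (2 * Real.pi))⁻¹)) •
      (GeodesicSlice.sigma d).restrict C
  have hη := GeodesicSlice.le_sssKernel hd2 hp hp_pos hC hβ0 hβ1 hβC
  have hηuniv : η univ = ENNReal.ofReal ε := by
    have e1 : GeodesicSlice.sigma d C = ENNReal.ofReal ((GeodesicSlice.sigma d).real C) :=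
      (ofReal_measureReal).symm
    rw [Measure.smul_apply, Measure.restrict_apply_univ, smul_eq_mul,
      ← GeodesicSlice.ofReal_area, e1, ← ENNReal.ofReal_inv_of_pos harea,
      ← ENNReal.ofReal_inv_of_pos Real.two_pi_pos, ← ENNReal.ofReal_mul (by positivity),
      ← ENNReal.ofReal_mul hβ0.le, ← ENNReal.ofReal_mul (by positivity)]
    congr 1
    rw [hε]
    ring
  have : IsFiniteMeasure η := ⟨by rw [hηuniv]; exact ENNReal.ofReal_lt_top⟩
  refine (GeodesicSlice.dTV_pow_le hη
    (GeodesicSlice.target_bind_sssKernel hd2 hp_lsc hp_pos) n x).trans_eq ?_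
  rw [hηuniv, ← ENNReal.ofReal_one, ← ENNReal.ofReal_sub _ hε0.le, hρ,
    ENNReal.ofReal_pow (by linarith)]
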